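/- **Setting.** Let $n\ge 2$, let $W\subset\mathbb R^{n+1}$ be compact with $\partial W$ a (possibly empty) embedded hypersurface of class $C^2$, and let $\Omega=\mathbb R^{n+1}\setminus W$. Let $\mathcal C$ be a spanning class for $W$: a non-empty family of smooth embeddings of $\mathbb S^1$ into $\Omega$ such that every smooth embedding of $\mathbb S^1$ homotopic in $\Omega$ to an element of $\mathcal C$ belongs to $\mathcal C$. A set is $\mathcal C$-spanning if it meets $\gamma(\mathbb S^1)$ for every $\gamma\in\mathcal C$. A set is $\mathcal H^n$-rectifiable if it is Borel, has finite $\mathcal H^n$-measure, and is covered up to an $\mathcal H^n$-null set by countably many Lipschitz images of $\mathbb R^n$. For $E$ of locally finite perimeter, $\partial^*E$ is its reduced boundary. Write $(K,E)\in\mathcal K$ if $E\subset\Omega$ is open, $K\subset\Omega$ is relatively closed in $\Omega$, $\mathcal H^n$-rectifiable and $\mathcal C$-spanning, and $\Omega\cap\mathrm{cl}(\partial^*E)=\Omega\cap\partial E\subset K$; set $$\mathcal F(K,E)=\mathcal H^n(\Omega\cap\partial^*E)+2\,\mathcal H^n(K\setminus\partial^*E).$$ **Lemma 3.2 (opening lemma).**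 Let $(K,E)\in\mathcal K$, and let $\Sigma\subset K$ be relatively closed in $K$ with empty interior relative to $K$, such that $K\setminus\Sigma$ is a smooth embedded hypersurface and there is $\nu\in C^\infty(K\setminus\Sigma;\mathbb S^n)$ with $\nu(x)^\perp=T_x(K\setminus\Sigma)$ for every $x\in K\setminus\Sigma$. Let $$M_0=(K\setminus\Sigma)\setminus\mathrm{cl}(E),\qquad M_1=(K\setminus\Sigma)\cap E,\qquad M=M_0\cup M_1 .$$ Call a continuous function $\rho:M\to(0,\infty)$ a tubular radius if $U_\rho=\{x+t\rho(x)\nu(x):x\in M,\ |t|<1\}$ is a tubular neighborhood of $M$, i.e. $U_\rho$ is open in $\mathbb R^{n+1}$ and $(x,s)\mapsto x+s\,\nu(x)$ is a diffeomorphism of $\{(x,s):x\in M,\ |s|<\rho(x)\}$ onto $U_\rho$. Then Lipschitz tubular radii exist. Let $\rho$ be any Lipschitz tubular radius and let $\|A_M\|(x)$ be the maximal absolute value of the principal curvatures of $M$ at $x$. For $\eta,\delta\in(0,1)$ and $x\in M$ set $$u(x)=\min\Big\{\eta,\ \tfrac12\,\mathrm{dist}(x,\Sigma\cup\partial E\cup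 W),\ \delta\,\rho(x),\ \frac{\delta}{\|A_M\|(x)}\Big\}$$ (with $\delta/0=\infty$ and $\mathrm{dist}(x,\emptyset)=\infty$), and $$A_k=\{x+t\,u(x)\,\nu(x):x\in M_k,\ 0<t<1\}\quad(k=0,1),\qquad F=F_{\eta,\delta}=A_0\cup\big(E\setminus\mathrm{cl}(A_1)\big).$$ Then for all $\eta,\delta\in(0,1)$ the set $F\subset\Omega$ is open, $\partial F$ is $\mathcal H^n$-rectifiable, and $K\subset\Omega\cap\partial F$; in particular $\Omega\cap\partial F$ is $\mathcal C$-spanning. Moreover $$\limsup_{\delta\to0^+}\ \limsup_{\eta\to0^+}\ \mathcal H^n(\Omega\cap\partial F_{\eta,\delta})\le\mathcal F(K,E).$$ -/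

import Mathlib

open Set Filter Topology MeasureTheory Metric
open scoped NNReal ENNReal Manifold ContDiff RealInnerProductSpace

noncomputable section

namespace SoapFilm

/-- The ambient Euclidean space `ℝ^{n+1}`. -/
abbrev Eu (n : ℕ) : Type := EuclideanSpace ℝ (Fin (n + 1))

/-- The `k`-dimensional Hausdorff measure on `ℝ^{n+1}`, with the usual normalization (it agrees
with Lebesgue measure on `k`-dimensional planes). -/
def hausdorff {n : ℕ} (k : ℕ) : Measure (Eu n) := Measure.euclideanHausdorffMeasure k

/-- `S` is `ℋ^k`-rectifiable: it is Borel, it is covered up to an `ℋ^k`-null set by countably many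
Lipschitz images of `ℝ^k`, and it has finite `ℋ^k`-measure. -/
def IsRectifiable {n : ℕ} (k : ℕ) (S : Set (Eu n)) : Prop :=
  MeasurableSet S ∧
  (∃ f : ℕ → EuclideanSpace ℝ (Fin k) → Eu n,
    (∀ i, ∃ L : ℝ≥0, LipschitzWith L (f i)) ∧ hausdorff k (S \ ⋃ i, range (f i)) = 0) ∧
  hausdorff k S < ⊤

/-- `S ⊆ ℝ^{n+1}` is an (embedded) hypersurface of class `C^k`: near each of its points it is the
zero set of a `C^k` function with nowhere vanishing differential. -/
def IsHypersurface {n : ℕ} (k : WithTop ℕ∞) (S : Set (Eu n)) : Prop :=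
  ∀ x ∈ S, ∃ (U : Set (Eu n)) (f : Eu n → ℝ), IsOpen U ∧ x ∈ U ∧ ContDiffOn ℝ k f U ∧
    (∀ y ∈ U, fderiv ℝ f y ≠ 0) ∧ S ∩ U = {y ∈ U | f y = 0}

/-- `ν` restricts to a smooth unit normal field on the smooth hypersurface `S`, that is
`ν ∈ C^∞(S; 𝕊^n)` and `ν(x)^⊥ = T_x S` for `x ∈ S`. The values of `ν` off `S` are irrelevant. -/
def IsUnitNormal {n : ℕ} (S : Set (Eu n)) (ν : Eu n → Eu n) : Prop :=
  ContDiffOn ℝ ∞ ν S ∧ ∀ x ∈ S, ‖ν x‖ = 1 ∧ tangentConeAt ℝ S x = {v | ⟪v, ν x⟫ = 0}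

/-- The divergence of a vector field. -/
def divergence {n : ℕ} (X : Eu n → Eu n) (x : Eu n) : ℝ :=
  ∑ i, (fderiv ℝ X x (EuclideanSpace.single i 1)) i

/-- `σ μ` is the Gauss-Green measure `μ_E` of `E`, written in polar form: `μ = |μ_E|` is a Radon
measure, `σ` is a Borel field with `|σ| = 1` `μ`-a.e., and `∫_E div X = ∫ X · σ dμ` for every
`X ∈ C^1_c`. The pair exists exactly when `E` has locally finite perimeter; `μ` is then unique and
`σ` is unique up to `μ`-null sets. -/
structure IsGaussGreen {n : ℕ} (E : Set (Eu n)) (μ : Measure (Eu n)) (σ : Eu n → Eu n) :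
    Prop where
  locallyFinite : IsLocallyFiniteMeasure μ
  measurable : Measurable σ
  unit : ∀ᵐ x ∂μ, ‖σ x‖ = 1
  integral_div : ∀ X : Eu n → Eu n, ContDiff ℝ 1 X → HasCompactSupport X →
    ∫ x in E, divergence X x = ∫ x, ⟪X x, σ x⟫ ∂μ

/-- The reduced boundary `∂^*E`: the points `x` of `spt |μ_E|` for which
`μ_E(B_r(x)) / |μ_E|(B_r(x))` converges, as `r → 0^+`, to a unit vector. -/
def reducedBoundary {n : ℕ} (E : Set (Eu n)) : Set (Eu n) :=
  {x | ∃ (μ : Measure (Eu n)) (σ : Eu n → Eu n), IsGaussGreen E μ σ ∧ x ∈ μ.support ∧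
    ∃ v : Eu n, ‖v‖ = 1 ∧
      Tendsto (fun r : ℝ => (μ.real (ball x r))⁻¹ • ∫ y in ball x r, σ y ∂μ) (𝓝[>] 0) (𝓝 v)}

/-- Two loops are homotopic in `Ω`. -/
def HomotopicIn {n : ℕ} (Ω : Set (Eu n)) (γ γ' : Circle → Eu n) : Prop :=
  ∃ H : unitInterval × Circle → Eu n, Continuous H ∧ (∀ p, H p ∈ Ω) ∧
    (∀ z, H (0, z) = γ z) ∧ (∀ z, H (1, z) = γ' z)

/-- `C` is a spanning class for `W`: a non-empty family of smooth embeddings of `𝕊^1` into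
`Ω = ℝ^{n+1} \ W`, closed under homotopy in `Ω` (among smooth embeddings). -/
structure IsSpanningClass {n : ℕ} (W : Set (Eu n)) (C : Set (Circle → Eu n)) : Prop where
  nonempty : C.Nonempty
  embedding : ∀ γ ∈ C, Manifold.IsSmoothEmbedding (𝓡 1) 𝓘(ℝ, Eu n) ∞ γ
  mapsTo : ∀ γ ∈ C, range γ ⊆ Wᶜ
  closed_homotopy : ∀ γ ∈ C, ∀ γ' : Circle → Eu n,
    Manifold.IsSmoothEmbedding (𝓡 1) 𝓘(ℝ, Eu n) ∞ γ' → HomotopicIn Wᶜ γ γ' → γ' ∈ C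

/-- `S` is `C`-spanning: it meets every curve of `C`. -/
def IsSpanning {n : ℕ} (C : Set (Circle → Eu n)) (S : Set (Eu n)) : Prop :=
  ∀ γ ∈ C, (S ∩ range γ).Nonempty

/-- `(K, E) ∈ 𝒦`, with `Ω = ℝ^{n+1} \ W`. -/
structure MemClassK {n : ℕ} (W : Set (Eu n)) (C : Set (Circle → Eu n)) (K E : Set (Eu n)) :
    Prop where
  isOpen_E : IsOpen E
  E_subset : E ⊆ Wᶜ
  closure_reducedBoundary : Wᶜ ∩ closure (reducedBoundary E) = Wᶜ ∩ frontier E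
  frontier_subset : Wᶜ ∩ frontier E ⊆ K
  K_subset : K ⊆ Wᶜ
  K_relClosed : Wᶜ ∩ closure K ⊆ K
  K_spanning : IsSpanning C K
  K_rectifiable : IsRectifiable n K

/-- The relaxed energy `𝓕(K, E) = ℋ^n(Ω ∩ ∂^*E) + 2 ℋ^n(K \ ∂^*E)`. -/
def relaxedEnergy {n : ℕ} (W K E : Set (Eu n)) : ℝ≥0∞ :=
  hausdorff n (Wᶜ ∩ reducedBoundary E) + 2 * hausdorff n (K \ reducedBoundary E)

/-- The normal tube `{x + t ρ(x) ν(x) : x ∈ M, |t| < 1}`. -/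
def normalTube {n : ℕ} (M : Set (Eu n)) (ν : Eu n → Eu n) (ρ : Eu n → ℝ) : Set (Eu n) :=
  {y | ∃ x ∈ M, ∃ t : ℝ, |t| < 1 ∧ y = x + (t * ρ x) • ν x}

/-- `ρ` is a continuous positive function on `M` for which the normal tube of radius `ρ` is a
tubular neighborhood of `M`: the tube is open and `(x, s) ↦ x + s ν(x)` is a diffeomorphism of
`{(x, s) : x ∈ M, |s| < ρ(x)}` onto it, `y ↦ (p y, s y)` being the smooth inverse. -/
structure IsTubularRadius {n : ℕ} (M : Set (Eu n)) (ν : Eu n → Eu n) (ρ : Eu n → ℝ) :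
    Prop where
  pos : ∀ x ∈ M, 0 < ρ x
  continuousOn : ContinuousOn ρ M
  isOpen_tube : IsOpen (normalTube M ν ρ)
  exists_inverse : ∃ (p : Eu n → Eu n) (s : Eu n → ℝ),
    ContDiffOn ℝ ∞ p (normalTube M ν ρ) ∧ ContDiffOn ℝ ∞ s (normalTube M ν ρ) ∧
    ∀ x ∈ M, ∀ t : ℝ, |t| < ρ x → p (x + t • ν x) = x ∧ s (x + t • ν x) = t

/-- `κ` is a principal curvature at `x` of the hypersurface `M` with unit normal `ν`: an eigenvalue
of the shape operator `-dν_x` on `T_x M = ν(x)^⊥`. On tangent vectors the derivative of `ν` within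
`M` does not depend on any choice. -/
def IsPrincipalCurvature {n : ℕ} (M : Set (Eu n)) (ν : Eu n → Eu n) (x : Eu n) (κ : ℝ) : Prop :=
  ∃ v : Eu n, v ≠ 0 ∧ ⟪v, ν x⟫ = 0 ∧ -(fderivWithin ℝ ν M x v) = κ • v

/-- `‖A_M‖(x)`: the maximal absolute value of a principal curvature of `M` at `x`. -/
def curvatureNorm {n : ℕ} (M : Set (Eu n)) (ν : Eu n → Eu n) (x : Eu n) : ℝ :=
  sSup {a : ℝ | ∃ κ : ℝ, IsPrincipalCurvature M ν x κ ∧ a = |κ|}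

/-- The exterior collapsed part `M_0 = (K \ Σ) \ cl E`. -/
def collapsedExt {n : ℕ} (K S E : Set (Eu n)) : Set (Eu n) := (K \ S) \ closure E

/-- The interior collapsed part `M_1 = (K \ Σ) ∩ E`. -/
def collapsedInt {n : ℕ} (K S E : Set (Eu n)) : Set (Eu n) := (K \ S) ∩ E

/-- The collapsed part `M = M_0 ∪ M_1`. -/
def collapsed {n : ℕ} (K S E : Set (Eu n)) : Set (Eu n) :=
  collapsedExt K S E ∪ collapsedInt K S E

/-- The thickness `u = min {η, dist(x, Σ ∪ ∂E ∪ W) / 2, δ ρ(x), δ / ‖A_M‖(x)}`. The minimum is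
taken in `[0, ∞]`, so that `δ / 0 = ∞` and the distance to the empty set is `∞`. -/
def thickness {n : ℕ} (W K S E : Set (Eu n)) (ν : Eu n → Eu n) (ρ : Eu n → ℝ) (η δ : ℝ)
    (x : Eu n) : ℝ :=
  (min (min (ENNReal.ofReal η) (infEDist x (S ∪ frontier E ∪ W) / 2))
    (min (ENNReal.ofReal (δ * ρ x))
      (ENNReal.ofReal δ / ENNReal.ofReal (curvatureNorm (collapsed K S E) ν x)))).toReal

/-- The one-sided layer `{x + t u(x) ν(x) : x ∈ M, 0 < t < 1}`. -/
def oneSidedLayer {n : ℕ} (M : Set (Eu n)) (ν : Eu n → Eu n) (u : Eu n → ℝ) : Set (Eu n) :=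
  {y | ∃ x ∈ M, ∃ t : ℝ, 0 < t ∧ t < 1 ∧ y = x + (t * u x) • ν x}

/-- The opened set `F = A_0 ∪ (E \ cl A_1)`. -/
def openedSet {n : ℕ} (W K S E : Set (Eu n)) (ν : Eu n → Eu n) (ρ : Eu n → ℝ) (η δ : ℝ) :
    Set (Eu n) :=
  oneSidedLayer (collapsedExt K S E) ν (thickness W K S E ν ρ η δ) ∪
    (E \ closure (oneSidedLayer (collapsedInt K S E) ν (thickness W K S E ν ρ η δ)))

end SoapFilm

end

open SoapFilm

/-!
Write `M` for the collapsed part, `Z = Σ ∪ ∂E ∪ W` and `u` for the thickness.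

**Tubular radii.** The inverse function theorem gives normal coordinates on a neighborhood of each
point of `M`. A quarter of the supremum of the admissible sizes of such neighborhoods is a
`1`-Lipschitz function of the point, and the quarter makes the normal map injective on the whole
tube (`exists_lipschitz_isTubularRadius`).

**The thickness is Lipschitz.** A tubular neighborhood contains no focal points, so every principal
curvature `κ` satisfies `|κ| ρ ≤ 1` (`abs_eigenvalue_mul_le`). Therefore `δ ρ ≤ δ / ‖A_M‖`, the
curvature term in `u` is redundant (`thickness_eq`), and `u` is a minimum of Lipschitz functions.
As the shape operator is symmetric, the same bound makes `ν` locally Lipschitz with constant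
`2 / ρ` (`IsTubularRadius.curvature_bounds`).

**Topology of the opened set.** In normal coordinates the layers are open. As `2 u ≤ dist(·, Z)`,
a sequence in a layer whose base points leave `M` converges to a point of `Z`, so the layers
accumulate in `Ω` only on themselves, on `K` and on the graph `Γ = {x + u(x) ν(x)}`
(`IsThickness.closure_layer_subset`). This gives `Ω ∩ ∂F ⊆ K ∪ Γ`
(`IsThickness.frontier_openedWith_subset`). Conversely the points of `M` see the layer on one side
only, a point of `∂E` is a limit either of points of `E` off the inner layer or of points of `M`,
and `K \ Σ` is dense in `K`; hence `K ⊆ ∂F` (`IsThickness.subset_frontier_openedWith`).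

**Area.** `ℋ^n(Ω ∩ ∂F) ≤ ℋ^n(K) + ℋ^n(Γ)`, and `M ⊆ K \ ∂^*E`, so it suffices that the upper
limit of `ℋ^n(Γ)` as `η → 0` is at most `ℋ^n(M)` (`eventually_hausdorff_graph_le`). The graph map
is locally Lipschitz with a constant independent of `η`, and with constant `1 + 2 ε` where `u = η`
and `η < ε ρ`; the measure of the rest of `M` tends to zero. Thus the inequality holds for each
fixed `δ`, already before `δ → 0`.
-/

namespace SoapFilm

/-! ### Hausdorff measure and locally Lipschitz maps -/

theorem euclideanHausdorffMeasure_image_le {X Y : Type*} [MetricSpace X] [MeasurableSpace X]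
    [BorelSpace X] [MetricSpace Y] [MeasurableSpace Y] [BorelSpace Y] {f : X → Y} {s : Set X}
    {c : ℝ≥0} (h : LipschitzOnWith c f s) (k : ℕ) :
    (Measure.euclideanHausdorffMeasure k : Measure Y) (f '' s) ≤
      (c : ℝ≥0∞) ^ k * (Measure.euclideanHausdorffMeasure k : Measure X) s := by
  have h1 := h.hausdorffMeasure_image_le (d := k) (Nat.cast_nonneg k)
  rw [ENNReal.rpow_natCast] at h1
  simp only [Measure.euclideanHausdorffMeasure_def, Measure.smul_apply, ENNReal.smul_def,
    smul_eq_mul]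
  calc _ ≤ _ := mul_le_mul_right h1 _
    _ = _ := by ring

theorem hausdorff_image_le {n k : ℕ} {f : Eu n → Eu n} {s : Set (Eu n)} {c : ℝ≥0}
    (h : LipschitzOnWith c f s) : hausdorff k (f '' s) ≤ (c : ℝ≥0∞) ^ k * hausdorff k s :=
  euclideanHausdorffMeasure_image_le h k

/-- Lindelöf: a set on which a hereditary property `P` holds locally is partitioned by countably
many measurable sets into pieces with property `P`. -/
theorem exists_measurable_partition {n : ℕ} {s : Set (Eu n)} {P : Set (Eu n) → Prop}
    (h0 : P ∅) (hP : ∀ a b, a ⊆ b → P b → P a) (h : ∀ x ∈ s, ∃ U ∈ 𝓝[s] x, P U) :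
    ∃ B : ℕ → Set (Eu n), (∀ i, MeasurableSet (B i)) ∧ Pairwise (Function.onFun Disjoint B) ∧
      s ⊆ ⋃ i, B i ∧ ∀ i, P (s ∩ B i) := by
  choose! U hU hPU using h
  have h1 : ∀ x ∈ s, ∃ V, IsOpen V ∧ x ∈ V ∧ V ∩ s ⊆ U x := fun x hx =>
    mem_nhdsWithin.1 (hU x hx)
  choose! V hVo hxV hVU using h1
  rcases s.eq_empty_or_nonempty with rfl | ⟨x0, hx0⟩
  · exact ⟨fun _ => ∅, by simp, by intro i j _; simp [Function.onFun], by simp, by simpa using h0⟩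
  obtain ⟨t, hts, htc, hcov⟩ := TopologicalSpace.countable_cover_nhdsWithin
    (f := fun x => V x) (s := s)
    (fun x hx => mem_nhdsWithin_of_mem_nhds ((hVo x hx).mem_nhds (hxV x hx)))
  have htne : t.Nonempty := by
    obtain ⟨i, hi, _⟩ := mem_iUnion₂.1 (hcov hx0)
    exact ⟨i, hi⟩
  obtain ⟨g, rfl⟩ := htc.exists_eq_range htne
  refine ⟨disjointed fun i => V (g i), fun i => ?_, disjoint_disjointed _, ?_, fun i => ?_⟩
  · exact MeasurableSet.disjointed (fun i => (hVo _ (hts ⟨i, rfl⟩)).measurableSet) i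
  · rw [iUnion_disjointed]
    simpa using hcov
  · refine hP _ _ ?_ (hPU (g i) (hts ⟨i, rfl⟩))
    intro y hy
    exact hVU _ (hts ⟨i, rfl⟩) ⟨disjointed_subset (fun i => V (g i)) i hy.2, hy.1⟩


/-- A map that is Lipschitz with constant `c` near every point of `s` increases `ℋ^k` on `s` by a
factor of at most `c ^ k`; no global Lipschitz bound on `s` is needed. -/
theorem hausdorff_image_le_of_locally {n k : ℕ} {f : Eu n → Eu n} {s : Set (Eu n)} {c : ℝ≥0}
    (h : ∀ x ∈ s, ∃ U ∈ 𝓝[s] x, LipschitzOnWith c f U) :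
    hausdorff k (f '' s) ≤ (c : ℝ≥0∞) ^ k * hausdorff k s := by
  obtain ⟨B, hBm, hBd, hsB, hBL⟩ := exists_measurable_partition
    (P := fun a => LipschitzOnWith c f a) (by simp) (fun a b hab hb => hb.mono hab) h
  have h1 : s = ⋃ i, s ∩ B i := by
    rw [← inter_iUnion]; exact (inter_eq_left.2 hsB).symm
  calc hausdorff k (f '' s) = hausdorff k (⋃ i, f '' (s ∩ B i)) := by
        rw [← image_iUnion, ← h1]
    _ ≤ ∑' i, hausdorff k (f '' (s ∩ B i)) := measure_iUnion_le _
    _ ≤ ∑' i, (c : ℝ≥0∞) ^ k * hausdorff k (s ∩ B i) :=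
        ENNReal.tsum_le_tsum fun i => hausdorff_image_le (hBL i)
    _ = (c : ℝ≥0∞) ^ k * ∑' i, hausdorff k (s ∩ B i) := ENNReal.tsum_mul_left
    _ = (c : ℝ≥0∞) ^ k * hausdorff k s := by
        congr 1
        have h2 : ∀ i, hausdorff k (s ∩ B i) = (hausdorff k).restrict s (B i) := fun i => by
          rw [Measure.restrict_apply (hBm i), inter_comm]
        simp_rw [h2]
        rw [← measure_iUnion hBd hBm, Measure.restrict_apply (MeasurableSet.iUnion hBm),
          inter_eq_right.2 hsB]

/-- `S` is covered, up to an `ℋ^k`-null set, by countably many Lipschitz images of `ℝ^k`. -/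
def HasLipschitzCover {n : ℕ} (k : ℕ) (S : Set (Eu n)) : Prop :=
  ∃ f : ℕ → EuclideanSpace ℝ (Fin k) → Eu n,
    (∀ i, ∃ L : ℝ≥0, LipschitzWith L (f i)) ∧ hausdorff k (S \ ⋃ i, range (f i)) = 0

theorem HasLipschitzCover.mono {n k : ℕ} {S T : Set (Eu n)} (h : HasLipschitzCover k T)
    (hST : S ⊆ T) : HasLipschitzCover k S := by
  obtain ⟨f, hf, h0⟩ := h
  exact ⟨f, hf, measure_mono_null (sdiff_subset_sdiff_left hST) h0⟩

theorem HasLipschitzCover.iUnion {n k : ℕ} {S : ℕ → Set (Eu n)}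
    (h : ∀ i, HasLipschitzCover k (S i)) : HasLipschitzCover k (⋃ i, S i) := by
  choose f hf h0 using h
  refine ⟨fun m => f m.unpair.1 m.unpair.2, fun m => hf _ _, ?_⟩
  refine measure_mono_null ?_ (measure_iUnion_null h0)
  rintro x ⟨hx, hxn⟩
  obtain ⟨i, hi⟩ := mem_iUnion.1 hx
  refine mem_iUnion.2 ⟨i, hi, fun hx' => hxn ?_⟩
  obtain ⟨j, hj⟩ := mem_iUnion.1 hx'
  exact mem_iUnion.2 ⟨Nat.pair i j, by simpa using hj⟩

theorem HasLipschitzCover.union {n k : ℕ} {S T : Set (Eu n)}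
    (hS : HasLipschitzCover k S) (hT : HasLipschitzCover k T) : HasLipschitzCover k (S ∪ T) := by
  refine (HasLipschitzCover.iUnion (S := fun i : ℕ => if i = 0 then S else T) fun i => ?_).mono ?_
  · by_cases h : i = 0 <;> simp [h, hS, hT]
  · rintro x (hx | hx)
    · exact mem_iUnion.2 ⟨0, by simpa using hx⟩
    · exact mem_iUnion.2 ⟨1, by simpa using hx⟩

theorem HasLipschitzCover.image_lipschitzOn {n k : ℕ} {S : Set (Eu n)} {g : Eu n → Eu n} {c : ℝ≥0}
    (hS : HasLipschitzCover k S) (hg : LipschitzOnWith c g S) : HasLipschitzCover k (g '' S) := by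
  obtain ⟨f, hf, h0⟩ := hS
  have h1 : ∀ i, ∃ (F : EuclideanSpace ℝ (Fin k) → Eu n) (L : ℝ≥0), LipschitzWith L F ∧
      EqOn (g ∘ f i) F (f i ⁻¹' S) := fun i => by
    obtain ⟨L, hL⟩ := hf i
    have h2 : LipschitzOnWith (c * L) (g ∘ f i) (f i ⁻¹' S) :=
      hg.comp hL.lipschitzOnWith (fun x hx => hx)
    obtain ⟨F, hF, hFe⟩ := h2.extend_finite_dimension
    exact ⟨F, _, hF, hFe⟩
  choose F L hF hFe using h1
  refine ⟨F, fun i => ⟨L i, hF i⟩, ?_⟩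
  refine measure_mono_null (t := g '' (S \ ⋃ i, range (f i))) ?_ ?_
  · rintro _ ⟨⟨x, hx, rfl⟩, hn⟩
    refine ⟨x, ⟨hx, fun hx' => hn ?_⟩, rfl⟩
    obtain ⟨i, y, rfl⟩ := mem_iUnion.1 hx'
    exact mem_iUnion.2 ⟨i, y, (hFe i hx).symm⟩
  · refine le_antisymm ((hausdorff_image_le (hg.mono sdiff_subset)).trans ?_) zero_le
    rw [h0, mul_zero]

theorem HasLipschitzCover.image_of_locally {n k : ℕ} {S : Set (Eu n)} {g : Eu n → Eu n}
    (hS : HasLipschitzCover k S) (hg : ∀ x ∈ S, ∃ U ∈ 𝓝[S] x, ∃ c, LipschitzOnWith c g U) :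
    HasLipschitzCover k (g '' S) := by
  obtain ⟨B, -, -, hsB, hBL⟩ :=
    exists_measurable_partition (P := fun a => ∃ c, LipschitzOnWith c g a)
      ⟨0, by simp⟩ (fun a b hab ⟨c, hb⟩ => ⟨c, hb.mono hab⟩) hg
  refine (HasLipschitzCover.iUnion (S := fun i => g '' (S ∩ B i)) fun i => ?_).mono ?_
  · obtain ⟨c, hc⟩ := hBL i
    exact (hS.mono inter_subset_left).image_lipschitzOn hc
  · rintro _ ⟨x, hx, rfl⟩
    obtain ⟨i, hi⟩ := mem_iUnion.1 (hsB hx)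
    exact mem_iUnion.2 ⟨i, x, ⟨hx, hi⟩, rfl⟩

/-! ### Local charts of a hypersurface -/

/-- Inverse function theorem at a point where the derivative is the identity, on a domain on which
the map and its inverse are both of class `C^k`. -/
theorem exists_localInverse {E : Type*} [NormedAddCommGroup E] [NormedSpace ℝ E] [CompleteSpace E]
    {k : WithTop ℕ∞} (hk : 1 ≤ k) {G : E → E} {U : Set E} (hU : IsOpen U)
    (hG : ContDiffOn ℝ k G U) {x : E} (hx : x ∈ U)
    (hG' : HasFDerivAt G (ContinuousLinearMap.id ℝ E) x) :
    ∃ e : OpenPartialHomeomorph E E, x ∈ e.source ∧ e.source ⊆ U ∧ (∀ y, e y = G y) ∧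
      ContDiffOn ℝ k e.symm e.target := by
  have hk0 : k ≠ 0 := (lt_of_lt_of_le one_pos hk).ne'
  have hGx : ContDiffAt ℝ k G x := hG.contDiffAt (hU.mem_nhds hx)
  have hG'' : HasFDerivAt G ((ContinuousLinearEquiv.refl ℝ E : E ≃L[ℝ] E) : E →L[ℝ] E) x := hG'
  let e0 := hGx.toOpenPartialHomeomorph G hG'' hk0
  have hc : ContinuousOn (fderiv ℝ G) U := hG.continuousOn_fderiv_of_isOpen hU hk
  have hO : IsOpen (U ∩ fderiv ℝ G ⁻¹' range ((↑) : (E ≃L[ℝ] E) → E →L[ℝ] E)) :=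
    hc.isOpen_inter_preimage hU (ContinuousLinearEquiv.isOpen (𝕜 := ℝ) (E := E) (F := E))
  refine ⟨e0.restrOpen _ hO, ?_, ?_, fun y => rfl, ?_⟩
  · rw [OpenPartialHomeomorph.restrOpen_source]
    exact ⟨hGx.mem_toOpenPartialHomeomorph_source hG'' hk0, hx,
      ⟨ContinuousLinearEquiv.refl ℝ E, by rw [hG''.fderiv]⟩⟩
  · rw [OpenPartialHomeomorph.restrOpen_source]
    exact fun y hy => hy.2.1
  · intro y hy
    have hs := (e0.restrOpen _ hO).map_target hy
    rw [OpenPartialHomeomorph.restrOpen_source] at hs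
    obtain ⟨-, hyU, A, hA⟩ := hs
    have hd : ContDiffAt ℝ k G ((e0.restrOpen _ hO).symm y) := hG.contDiffAt (hU.mem_nhds hyU)
    refine ((e0.restrOpen _ hO).contDiffAt_symm (f₀' := A) hy ?_ hd).contDiffWithinAt
    rw [hA]
    exact (hd.differentiableAt hk0).hasFDerivAt

/-- Near each of its points, a hypersurface is straightened to a hyperplane by a diffeomorphism
which fixes the point and whose derivative there is the identity. -/
theorem IsHypersurface.exists_chart {n : ℕ} {k : WithTop ℕ∞} (hk : 1 ≤ k) {S : Set (Eu n)}
    (hS : IsHypersurface k S) {x : Eu n} (hx : x ∈ S) :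
    ∃ (N : Eu n) (e : OpenPartialHomeomorph (Eu n) (Eu n)), N ≠ 0 ∧ x ∈ e.source ∧ e x = x ∧
      ContDiffOn ℝ k e e.source ∧ ContDiffOn ℝ k e.symm e.target ∧
      HasFDerivAt e (ContinuousLinearMap.id ℝ (Eu n)) x ∧
      ∀ y ∈ e.source, (y ∈ S ↔ ⟪e y - x, N⟫ = 0) := by
  obtain ⟨U, f, hU, hxU, hf, hf0, hSU⟩ := hS x hx
  have hk0 : k ≠ 0 := (lt_of_lt_of_le one_pos hk).ne'
  have hfx : f x = 0 := (hSU ▸ (⟨hx, hxU⟩ : x ∈ S ∩ U) : x ∈ {y ∈ U | f y = 0}).2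
  set N : Eu n := (InnerProductSpace.toDual ℝ (Eu n)).symm (fderiv ℝ f x) with hN
  have hNf : ∀ v, ⟪v, N⟫ = fderiv ℝ f x v := fun v => by
    rw [real_inner_comm, hN, InnerProductSpace.toDual_symm_apply]
  have hN0 : N ≠ 0 := by simpa [hN] using hf0 x hxU
  -- `w` is dual to the gradient `N`; it is chosen so that `⟪G y - x, N⟫ = f y` below
  set w : Eu n := (‖N‖ ^ 2)⁻¹ • N with hw
  have hwN : ⟪w, N⟫ = 1 := by
    rw [hw, inner_smul_left, real_inner_self_eq_norm_sq]
    have : ‖N‖ ^ 2 ≠ 0 := by positivity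
    simp [this]
  set G : Eu n → Eu n := fun y => y + (f y - fderiv ℝ f x (y - x)) • w with hG
  have hfd : HasFDerivAt f (fderiv ℝ f x) x :=
    ((hf.contDiffAt (hU.mem_nhds hxU)).differentiableAt hk0).hasFDerivAt
  have hG' : HasFDerivAt G (ContinuousLinearMap.id ℝ (Eu n)) x := by
    have h1 : HasFDerivAt (fun y => fderiv ℝ f x (y - x)) (fderiv ℝ f x) x := by
      exact ((fderiv ℝ f x).hasFDerivAt.comp x ((hasFDerivAt_id x).sub_const x)).congr_fderiv
        (ContinuousLinearMap.comp_id _)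
    refine ((hasFDerivAt_id (𝕜 := ℝ) x).add ((hfd.sub h1).smul_const w)).congr_fderiv ?_
    simp
  have hGc : ContDiffOn ℝ k G U := by
    refine contDiffOn_id.add ((hf.sub ?_).smul contDiffOn_const)
    exact ((fderiv ℝ f x).contDiff.comp (contDiff_id.sub contDiff_const)).contDiffOn
  obtain ⟨e, hxe, heU, heG, hes⟩ := exists_localInverse hk hU hGc hxU hG'
  have heq : (e : Eu n → Eu n) = G := funext heG
  refine ⟨N, e, hN0, hxe, ?_, ?_, hes, ?_, fun y hy => ?_⟩
  · rw [heq]; simp [hG, hfx]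
  · rw [heq]; exact hGc.mono heU
  · rw [heq]; exact hG'
  · have h1 : ⟪e y - x, N⟫ = f y := by
      rw [heq]
      have : G y - x = (y - x) + (f y - fderiv ℝ f x (y - x)) • w := by simp only [hG]; abel
      rw [this, inner_add_left, inner_smul_left, hwN, hNf]
      simp
    rw [h1]
    constructor
    · intro h
      exact (hSU ▸ (⟨h, heU hy⟩ : y ∈ S ∩ U) : y ∈ {y ∈ U | f y = 0}).2
    · intro h
      exact (hSU.symm ▸ (⟨heU hy, h⟩ : y ∈ {y ∈ U | f y = 0}) : y ∈ S ∩ U).1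

end SoapFilm

namespace SoapFilm

/-! ### The unit normal and the shape operator -/

/-- The orthogonal projection onto the hyperplane `v^⊥`, for a unit vector `v`. -/
noncomputable def hyperplaneProj {n : ℕ} (v : Eu n) : Eu n →L[ℝ] Eu n :=
  ContinuousLinearMap.id ℝ (Eu n) - (innerSL ℝ v).smulRight v

theorem hyperplaneProj_apply {n : ℕ} (v w : Eu n) : hyperplaneProj v w = w - ⟪v, w⟫ • v := rfl

theorem inner_hyperplaneProj {n : ℕ} {v : Eu n} (hv : ‖v‖ = 1) (w : Eu n) :
    ⟪hyperplaneProj v w, v⟫ = 0 := by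
  rw [hyperplaneProj_apply, inner_sub_left, inner_smul_left, real_inner_self_eq_norm_sq, hv,
    real_inner_comm]
  simp

theorem hyperplaneProj_of_inner {n : ℕ} {v w : Eu n} (h : ⟪w, v⟫ = 0) :
    hyperplaneProj v w = w := by
  rw [hyperplaneProj_apply, real_inner_comm, h]; simp

variable {n : ℕ} {S : Set (Eu n)} {ν : Eu n → Eu n} {x : Eu n}

/-- A function that vanishes on a hypersurface has differential zero on the tangent space. -/
theorem fderiv_tangent_eq_zero {F : Type*} [NormedAddCommGroup F] [NormedSpace ℝ F]
    (hν : IsUnitNormal S ν) (hx : x ∈ S) {f : Eu n → F} {f' : Eu n →L[ℝ] F}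
    (hf : HasFDerivAt f f' x) (h0 : ∀ᶠ y in 𝓝[S] x, f y = 0) {v : Eu n} (hv : ⟪v, ν x⟫ = 0) :
    f' v = 0 := by
  have h1 : HasFDerivWithinAt f (0 : Eu n →L[ℝ] F) S x :=
    (hasFDerivWithinAt_const (0 : F) x S).congr_of_eventuallyEq h0 (h0.self_of_nhdsWithin hx)
  have h2 : v ∈ tangentConeAt ℝ S x := by rw [(hν.2 x hx).2]; exact hv
  simpa using hf.hasFDerivWithinAt.unique_on h1 h2

/-- A vector whose orthogonal complement contains the tangent space is a multiple of the unit
normal. -/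
theorem eq_inner_smul_of_forall {N v : Eu n} (hv : ‖v‖ = 1)
    (h : ∀ w : Eu n, ⟪w, v⟫ = 0 → ⟪w, N⟫ = 0) : N = ⟪v, N⟫ • v := by
  have h1 : ⟪hyperplaneProj v N, N⟫ = 0 := h _ (inner_hyperplaneProj hv N)
  have h2 : ⟪hyperplaneProj v N, hyperplaneProj v N⟫ = 0 := by
    conv_lhs => rw [hyperplaneProj_apply v N, inner_sub_right, inner_smul_right]
    rw [← hyperplaneProj_apply, inner_hyperplaneProj hv, h1]; simp
  rw [inner_self_eq_zero, hyperplaneProj_apply, sub_eq_zero] at h2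
  exact h2

/-- A straightening chart whose model hyperplane is the tangent space at the given point. -/
theorem IsHypersurface.exists_normal_chart (hS : IsHypersurface ∞ S) (hν : IsUnitNormal S ν)
    (hx : x ∈ S) :
    ∃ e : OpenPartialHomeomorph (Eu n) (Eu n), x ∈ e.source ∧ e x = x ∧
      ContDiffOn ℝ ∞ e e.source ∧ ContDiffOn ℝ ∞ e.symm e.target ∧
      HasFDerivAt e (ContinuousLinearMap.id ℝ (Eu n)) x ∧
      ∀ y ∈ e.source, (y ∈ S ↔ ⟪e y - x, ν x⟫ = 0) := by
  obtain ⟨N, e, hN, hxe, hex, he, hes, he', hSe⟩ := hS.exists_chart (by simp) hx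
  refine ⟨e, hxe, hex, he, hes, he', fun y hy => ?_⟩
  have h1 : HasFDerivAt (fun y => ⟪N, e y - x⟫) (innerSL ℝ N) x :=
    (((innerSL ℝ N).hasFDerivAt (x := e x - x)).comp (f := fun y => e y - x) x
      (he'.sub_const x)).congr_fderiv
      (ContinuousLinearMap.comp_id _)
  have h2 : ∀ᶠ y in 𝓝[S] x, ⟪N, e y - x⟫ = 0 := by
    filter_upwards [self_mem_nhdsWithin,
      mem_nhdsWithin_of_mem_nhds (e.open_source.mem_nhds hxe)] with y hy hy'
    rw [real_inner_comm]; exact (hSe y hy').1 hy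
  have h3 : ∀ w : Eu n, ⟪w, ν x⟫ = 0 → ⟪w, N⟫ = 0 := fun w hw => by
    have := fderiv_tangent_eq_zero hν hx h1 h2 hw
    rw [innerSL_apply_apply] at this
    rwa [real_inner_comm]
  have h4 := eq_inner_smul_of_forall (hν.2 x hx).1 h3
  have h5 : ⟪ν x, N⟫ ≠ 0 := fun h => hN (by rw [h4, h, zero_smul])
  rw [hSe y hy, h4, inner_smul_right, mul_eq_zero]
  simp [h5]

/-- A smooth section `σ` of the projection to the tangent space at `x`, together with a chart `e`
straightening `S`; `σ ∘ e` is a local retraction onto `S`. -/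
theorem IsHypersurface.exists_section (hS : IsHypersurface ∞ S) (hν : IsUnitNormal S ν)
    (hx : x ∈ S) :
    ∃ (V O : Set (Eu n)) (σ e : Eu n → Eu n), IsOpen V ∧ x ∈ V ∧ IsOpen O ∧ x ∈ O ∧
      ContDiffOn ℝ ∞ σ V ∧ MapsTo σ V S ∧ HasFDerivAt σ (hyperplaneProj (ν x)) x ∧
      ContDiffOn ℝ ∞ e O ∧ MapsTo e O V ∧ e x = x ∧
      HasFDerivAt e (ContinuousLinearMap.id ℝ (Eu n)) x ∧
      (∀ y ∈ S ∩ O, σ (e y) = y ∧ ⟪e y - x, ν x⟫ = 0) ∧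
      ∀ (q : Eu n) (a : ℝ), σ (q + a • ν x) = σ q := by
  obtain ⟨e, hxe, hex, he, hes, he', hSe⟩ := hS.exists_normal_chart hν hx
  have hνx := (hν.2 x hx).1
  set L : Eu n → Eu n := fun q => x + hyperplaneProj (ν x) (q - x) with hL
  have hLx : L x = x := by simp [hL]
  have hLc : ContDiff ℝ ∞ L :=
    contDiff_const.add ((hyperplaneProj (ν x)).contDiff.comp (contDiff_id.sub contDiff_const))
  have hLd : HasFDerivAt L (hyperplaneProj (ν x)) x :=
    (((hyperplaneProj (ν x)).hasFDerivAt.comp x ((hasFDerivAt_id x).sub_const x)).const_add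
      x).congr_fderiv (ContinuousLinearMap.comp_id _)
  have hxt : x ∈ e.target := by simpa [hex] using e.map_source hxe
  have hesx : e.symm x = x := by
    conv_lhs => rw [← hex]
    exact e.left_inv hxe
  have hVo : IsOpen (L ⁻¹' e.target) := e.open_target.preimage hLc.continuous
  have hsd : HasFDerivAt e.symm (ContinuousLinearMap.id ℝ (Eu n)) x :=
    e.hasFDerivAt_symm (f' := ContinuousLinearEquiv.refl ℝ (Eu n)) hxt (by rw [hesx]; exact he')
  refine ⟨L ⁻¹' e.target, e.source ∩ e ⁻¹' (L ⁻¹' e.target), e.symm ∘ L, e, hVo, ?_,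
    e.isOpen_inter_preimage hVo, ⟨hxe, ?_⟩, ?_, ?_, ?_, he.mono inter_subset_left,
    fun y hy => hy.2, hex, he', ?_, ?_⟩
  · simpa [hLx] using hxt
  · simpa [hex, hLx] using hxt
  · exact hes.comp hLc.contDiffOn (fun q hq => hq)
  · intro q hq
    have h1 := e.map_target hq
    refine (hSe _ h1).2 ?_
    rw [e.right_inv hq]
    simp only [hL, add_sub_cancel_left]
    exact inner_hyperplaneProj hνx _
  · have hsd' : HasFDerivAt e.symm (ContinuousLinearMap.id ℝ (Eu n)) (L x) := by rwa [hLx]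
    exact (hsd'.comp x hLd).congr_fderiv (ContinuousLinearMap.id_comp _)
  · rintro y ⟨hyS, hye, hyV⟩
    have h1 := (hSe y hye).1 hyS
    refine ⟨?_, h1⟩
    simp only [Function.comp, hL]
    rw [hyperplaneProj_of_inner h1, add_sub_cancel, e.left_inv hye]
  · intro q a
    have : L (q + a • ν x) = L q := by
      simp only [hL]
      rw [add_sub_right_comm, map_add, map_smul]
      have : hyperplaneProj (ν x) (ν x) = 0 := by
        rw [hyperplaneProj_apply, real_inner_self_eq_norm_sq, hνx]; simp
      rw [this]; simp
    simp only [Function.comp, this]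

/-- A retraction `τ` of a neighborhood of `x` onto `S` whose derivative at `x` is the
orthogonal projection onto the tangent space, and such that `ν ∘ τ` is a smooth extension of `ν`.
As `ν` is only known to be smooth *within* `S`, this extension is what gives access to the calculus
of open sets. -/
theorem IsHypersurface.exists_retraction (hS : IsHypersurface ∞ S) (hν : IsUnitNormal S ν)
    (hx : x ∈ S) :
    ∃ (O : Set (Eu n)) (τ : Eu n → Eu n), IsOpen O ∧ x ∈ O ∧
      ContDiffOn ℝ ∞ (ν ∘ τ) O ∧ MapsTo τ O S ∧ (∀ y ∈ S ∩ O, τ y = y) ∧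
      HasFDerivAt τ (hyperplaneProj (ν x)) x := by
  obtain ⟨V, O, σ, e, hV, hxV, hO, hxO, hσ, hσS, hσd, he, heV, hex, hed, hσe, -⟩ :=
    hS.exists_section hν hx
  have hτ : ContDiffOn ℝ ∞ (σ ∘ e) O := hσ.comp he heV
  have hτS : MapsTo (σ ∘ e) O S := hσS.comp heV
  refine ⟨O, σ ∘ e, hO, hxO, hν.1.comp hτ hτS, hτS, fun y hy => (hσe y hy).1, ?_⟩
  have hσd' : HasFDerivAt σ (hyperplaneProj (ν x)) (e x) := by rwa [hex]
  exact (hσd'.comp x hed).congr_fderiv (ContinuousLinearMap.comp_id _)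

/-- The shape operator (up to sign), extended by zero to the normal direction: a symmetric
operator which is the strict derivative at `x` of an extension `ν ∘ τ` of `ν`, with `τ` a local
retraction onto `S`. Symmetry holds because `ν` is parallel to the gradient of a local defining
function `f` of `S`, so that on tangent vectors the operator is a multiple of the Hessian of `f`. -/
theorem IsHypersurface.exists_shapeOperator (hS : IsHypersurface ∞ S) (hν : IsUnitNormal S ν)
    (hx : x ∈ S) :
    ∃ (D : Eu n →L[ℝ] Eu n) (O : Set (Eu n)) (τ : Eu n → Eu n), IsOpen O ∧ x ∈ O ∧
      MapsTo τ O S ∧ (∀ y ∈ S ∩ O, τ y = y) ∧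
      HasFDerivAt τ (hyperplaneProj (ν x)) x ∧ HasStrictFDerivAt (ν ∘ τ) D x ∧
      (∀ v, ⟪D v, ν x⟫ = 0) ∧ ∀ v w, ⟪D v, w⟫ = ⟪v, D w⟫ := by
  obtain ⟨O, τ, hO, hxO, hg, hτS, hτe, hτd⟩ := hS.exists_retraction hν hx
  have hνx := (hν.2 x hx).1
  have hτx : τ x = x := hτe x ⟨hx, hxO⟩
  have hgs : HasStrictFDerivAt (ν ∘ τ) (fderiv ℝ (ν ∘ τ) x) x :=
    (hg.contDiffAt (hO.mem_nhds hxO)).hasStrictFDerivAt (by simp)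
  set D := fderiv ℝ (ν ∘ τ) x with hD
  -- differentiate `|ν ∘ τ|² = 1`
  have hDn : ∀ v, ⟪D v, ν x⟫ = 0 := by
    have h1 : HasFDerivAt (fun y => ⟪(ν ∘ τ) y, (ν ∘ τ) y⟫)
        ((0 : Eu n →L[ℝ] ℝ)) x := by
      refine (hasFDerivAt_const (1 : ℝ) x).congr_of_eventuallyEq ?_
      filter_upwards [hO.mem_nhds hxO] with y hy
      simp [(hν.2 _ (hτS hy)).1]
    have h2 := hgs.hasFDerivAt.inner ℝ hgs.hasFDerivAt
    intro v
    have h3 := congrArg (fun A : Eu n →L[ℝ] ℝ => A v) (h2.unique h1)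
    simp [fderivInnerCLM_apply, hτx] at h3
    rw [real_inner_comm (D v)] at h3
    linarith
  -- differentiate `ν ∘ τ ∘ τ = ν ∘ τ`
  have hDQ : ∀ v, D (hyperplaneProj (ν x) v) = D v := by
    have h1 : HasFDerivAt (ν ∘ τ) (D.comp (hyperplaneProj (ν x))) x := by
      have h2 : HasFDerivAt (ν ∘ τ) D (τ x) := by rw [hτx]; exact hgs.hasFDerivAt
      refine (h2.comp x hτd).congr_of_eventuallyEq ?_
      have h3 : ∀ᶠ y in 𝓝 x, τ y ∈ O := by
        exact hτd.continuousAt.eventually_mem (by rw [hτx]; exact hO.mem_nhds hxO)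
      filter_upwards [h3, hO.mem_nhds hxO] with y hy hyO
      simp [Function.comp, hτe (τ y) ⟨hτS hyO, hy⟩]
    intro v
    exact congrArg (fun A : Eu n →L[ℝ] Eu n => A v) (h1.unique hgs.hasFDerivAt)
  have hsym : ∀ v w, ⟪v, ν x⟫ = 0 → ⟪w, ν x⟫ = 0 → ⟪D v, w⟫ = ⟪v, D w⟫ := by
    obtain ⟨U, f, hU, hxU, hf, hf0, hSU⟩ := hS x hx
    have hfx : ContDiffAt ℝ ∞ f x := hf.contDiffAt (hU.mem_nhds hxU)
    have hff : HasFDerivAt (fderiv ℝ f) (fderiv ℝ (fderiv ℝ f) x) x :=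
      ((hfx.fderiv_right (m := 1) (by norm_cast)).differentiableAt (by simp)).hasFDerivAt
    have hsymm : IsSymmSndFDerivAt ℝ f x := hfx.isSymmSndFDerivAt (by
      simp only [minSmoothness_of_isRCLikeNormedField]; norm_cast)
    have hker : ∀ y ∈ S ∩ U, ∀ v, ⟪v, ν y⟫ = 0 → fderiv ℝ f y v = 0 := by
      rintro y ⟨hyS, hyU⟩ v hv
      refine fderiv_tangent_eq_zero hν hyS
        ((hf.contDiffAt (hU.mem_nhds hyU)).differentiableAt (by simp)).hasFDerivAt ?_ hv
      filter_upwards [self_mem_nhdsWithin, mem_nhdsWithin_of_mem_nhds (hU.mem_nhds hyU)]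
        with z hz hz'
      exact (hSU ▸ (⟨hz, hz'⟩ : z ∈ S ∩ U) : z ∈ {y ∈ U | f y = 0}).2
    have hdec : ∀ y ∈ S ∩ U, ∀ w, fderiv ℝ f y w = ⟪ν y, w⟫ * fderiv ℝ f y (ν y) := by
      intro y hy w
      have h1 := hker y hy _ (inner_hyperplaneProj (hν.2 y hy.1).1 w)
      rw [hyperplaneProj_apply, map_sub, map_smul, sub_eq_zero] at h1
      simpa using h1
    -- differentiate the identity `hdec` along `τ`, paired with a fixed tangent vector
    have hτU : ∀ᶠ y in 𝓝 x, τ y ∈ U := by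
      exact hτd.continuousAt.eventually_mem (by rw [hτx]; exact hU.mem_nhds hxU)
    have hfτ : HasFDerivAt (fun y => fderiv ℝ f (τ y))
        ((fderiv ℝ (fderiv ℝ f) x).comp (hyperplaneProj (ν x))) x := by
      have : HasFDerivAt (fderiv ℝ f) (fderiv ℝ (fderiv ℝ f) x) (τ x) := by rwa [hτx]
      exact this.comp x hτd
    have key : ∀ v w, ⟪v, ν x⟫ = 0 → ⟪w, ν x⟫ = 0 →
        fderiv ℝ (fderiv ℝ f) x v w = ⟪D v, w⟫ * fderiv ℝ f x (ν x) := by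
      intro v w hv hw
      have h1 : HasFDerivAt (fun y => fderiv ℝ f (τ y) w)
          (((fderiv ℝ (fderiv ℝ f) x).comp (hyperplaneProj (ν x))).flip w) x := by
        refine (hfτ.clm_apply (hasFDerivAt_const w x)).congr_fderiv ?_
        ext v; simp
      have h2 := (hgs.hasFDerivAt.inner ℝ (hasFDerivAt_const w x)).mul
        (hfτ.clm_apply hgs.hasFDerivAt)
      have h3 : (fun y => fderiv ℝ f (τ y) w) =ᶠ[𝓝 x]
          fun y => ⟪(ν ∘ τ) y, w⟫ * fderiv ℝ f (τ y) ((ν ∘ τ) y) := by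
        filter_upwards [hτU, hO.mem_nhds hxO] with y hy hyO
        exact hdec (τ y) ⟨hτS hyO, hy⟩ w
      have h4 := congrArg (fun A : Eu n →L[ℝ] ℝ => A v)
        ((h1.congr_of_eventuallyEq h3.symm).unique h2)
      have hw' : ⟪ν x, w⟫ = 0 := by rwa [real_inner_comm]
      simpa [fderivInnerCLM_apply, hτx, hw', hyperplaneProj_of_inner hv, mul_comm] using h4
    have hne : fderiv ℝ f x (ν x) ≠ 0 := by
      intro h0
      refine hf0 x hxU (ContinuousLinearMap.ext fun w => ?_)
      rw [hdec x ⟨hx, hxU⟩ w, h0]; simp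
    intro v w hv hw
    have h1 := key v w hv hw
    have h2 := key w v hw hv
    rw [hsymm.eq v w, h2] at h1
    rw [real_inner_comm (D w) v]
    exact (mul_right_cancel₀ hne h1).symm
  refine ⟨D, O, τ, hO, hxO, hτS, hτe, hτd, hgs, hDn, fun v w => ?_⟩
  have h1 : ∀ v w, ⟪D v, hyperplaneProj (ν x) w⟫ = ⟪D v, w⟫ := fun v w => by
    rw [hyperplaneProj_apply, inner_sub_right, inner_smul_right, hDn]; simp
  rw [← h1 v w, ← hDQ v, hsym _ _ (inner_hyperplaneProj hνx v) (inner_hyperplaneProj hνx w), hDQ,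
    real_inner_comm, h1, real_inner_comm]

end SoapFilm

namespace SoapFilm

variable {n : ℕ} {S : Set (Eu n)} {ν : Eu n → Eu n} {x : Eu n}

/-! ### Existence of Lipschitz tubular radii -/

/-- `r` is an admissible size at `x`: on an open set `O`, normal coordinates `(p, s)` are smooth,
invert `(z, t) ↦ z + t ν(z)` for all `z ∈ S ∩ B_r(x)` and `|t| < r`, and take values in `S × ℝ`. -/
def IsTubeSize (S : Set (Eu n)) (ν : Eu n → Eu n) (x : Eu n) (r : ℝ) : Prop :=
  ∃ (O : Set (Eu n)) (p : Eu n → Eu n) (s : Eu n → ℝ), IsOpen O ∧ ContDiffOn ℝ ∞ p O ∧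
    ContDiffOn ℝ ∞ s O ∧ (∀ y ∈ O, p y ∈ S ∧ y = p y + s y • ν (p y)) ∧
    ∀ z ∈ S, dist z x < r → ∀ t : ℝ, |t| < r →
      z + t • ν z ∈ O ∧ p (z + t • ν z) = z ∧ s (z + t • ν z) = t

theorem IsTubeSize.mono {y : Eu n} {r r' : ℝ} (h : IsTubeSize S ν x r) (hr : r' + dist y x ≤ r) :
    IsTubeSize S ν y r' := by
  obtain ⟨O, p, s, hO, hp, hs, hO', hz⟩ := h
  have := dist_nonneg (x := y) (y := x)
  refine ⟨O, p, s, hO, hp, hs, hO', fun z hzS hzy t ht => hz z hzS ?_ t (by linarith)⟩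
  linarith [dist_triangle z y x]

theorem IsHypersurface.exists_isTubeSize (hS : IsHypersurface ∞ S) (hν : IsUnitNormal S ν)
    (hx : x ∈ S) : ∃ r, 0 < r ∧ IsTubeSize S ν x r := by
  obtain ⟨V, O, σ, e, hV, hxV, hO, hxO, hσ, hσS, hσd, he, heV, hex, hed, hσe, hσa⟩ :=
    hS.exists_section hν hx
  have hνx := (hν.2 x hx).1
  have hσx : σ x = x := by
    have := (hσe x ⟨hx, hxO⟩).1
    rwa [hex] at this
  set a : Eu n → ℝ := fun q => ⟪ν x, q - x⟫ with ha
  have hac : ContDiff ℝ ∞ a := (innerSL ℝ (ν x)).contDiff.comp (contDiff_id.sub contDiff_const)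
  have had : HasFDerivAt a (innerSL ℝ (ν x)) x :=
    ((innerSL ℝ (ν x)).hasFDerivAt.comp x ((hasFDerivAt_id x).sub_const x)).congr_fderiv
      (ContinuousLinearMap.comp_id _)
  have hνσ : ContDiffOn ℝ ∞ (ν ∘ σ) V := hν.1.comp hσ hσS
  have hνσd : HasFDerivAt (ν ∘ σ) (fderiv ℝ (ν ∘ σ) x) x :=
    ((hνσ.contDiffAt (hV.mem_nhds hxV)).differentiableAt (by simp)).hasFDerivAt
  set G : Eu n → Eu n := fun q => σ q + a q • (ν ∘ σ) q with hG
  have hGc : ContDiffOn ℝ ∞ G V := hσ.add (hac.contDiffOn.smul hνσ)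
  have hGd : HasFDerivAt G (ContinuousLinearMap.id ℝ (Eu n)) x := by
    refine (hσd.add (had.smul hνσd)).congr_fderiv ?_
    ext1 v
    simp [ha, hσx, hyperplaneProj_apply]
  obtain ⟨e2, hxe2, he2V, he2G, he2s⟩ := exists_localInverse (by simp) hV hGc hxV hGd
  have hmaps : MapsTo e2.symm e2.target V := fun y hy => he2V (e2.map_target hy)
  have hcont : ContinuousAt (fun w : Eu n × ℝ => e w.1 + w.2 • ν x) (x, 0) := by
    have h1 : ContinuousAt (fun w : Eu n × ℝ => e w.1) (x, 0) :=
      ContinuousAt.comp (f := Prod.fst) (g := e) (x := ((x, 0) : Eu n × ℝ)) hed.continuousAt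
        continuousAt_fst
    exact h1.add (continuousAt_snd.smul continuousAt_const)
  have hev : ∀ᶠ w in 𝓝 ((x, 0) : Eu n × ℝ), e w.1 + w.2 • ν x ∈ e2.source ∧ w.1 ∈ O := by
    refine (hcont.eventually_mem ?_).and (continuousAt_fst.eventually_mem (hO.mem_nhds hxO))
    simpa [hex] using e2.open_source.mem_nhds hxe2
  obtain ⟨r, hr, hball⟩ := Metric.eventually_nhds_iff.1 hev
  refine ⟨r, hr, e2.target, σ ∘ e2.symm, a ∘ e2.symm, e2.open_target, hσ.comp he2s hmaps,
    hac.comp_contDiffOn he2s, fun y hy => ⟨hσS (hmaps hy), ?_⟩, fun z hzS hzx t ht => ?_⟩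
  · conv_lhs => rw [← e2.right_inv hy, he2G]
    rfl
  · obtain ⟨hqs, hzO⟩ := hball (y := (z, t)) (by
      rw [Prod.dist_eq]; exact max_lt hzx (by simpa [Real.dist_eq] using ht))
    simp only at hqs hzO
    obtain ⟨hz1, hz2⟩ := hσe z ⟨hzS, hzO⟩
    have hσq : σ (e z + t • ν x) = z := by rw [hσa, hz1]
    have haq : a (e z + t • ν x) = t := by
      simp only [ha]
      rw [add_sub_right_comm, inner_add_right, real_inner_comm, hz2, inner_smul_right,
        real_inner_self_eq_norm_sq, hνx]
      simp
    have hGq : e2 (e z + t • ν x) = z + t • ν z := by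
      rw [he2G]; simp only [hG, Function.comp, hσq, haq]
    have hsymm : e2.symm (z + t • ν z) = e z + t • ν x := by rw [← hGq, e2.left_inv hqs]
    refine ⟨hGq ▸ e2.map_source hqs, ?_, ?_⟩
    · simp only [Function.comp, hsymm, hσq]
    · simp only [Function.comp, hsymm, haq]

/-- A quarter of the largest admissible size: a `1`-Lipschitz tubular radius. -/
noncomputable def tubeRadius (S : Set (Eu n)) (ν : Eu n → Eu n) (x : Eu n) : ℝ :=
  sSup {r | r ≤ 1 ∧ IsTubeSize S ν x r} / 4

theorem mem_normalTube_iff {ρ : Eu n → ℝ} (hρ : ∀ x ∈ S, 0 < ρ x) {y : Eu n} :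
    y ∈ normalTube S ν ρ ↔ ∃ x ∈ S, ∃ s : ℝ, |s| < ρ x ∧ y = x + s • ν x := by
  constructor
  · rintro ⟨x, hx, t, ht, rfl⟩
    refine ⟨x, hx, t * ρ x, ?_, rfl⟩
    rw [abs_mul, abs_of_pos (hρ x hx)]
    exact mul_lt_of_lt_one_left (hρ x hx) ht
  · rintro ⟨x, hx, s, hs, rfl⟩
    refine ⟨x, hx, s / ρ x, ?_, ?_⟩
    · rw [abs_div, abs_of_pos (hρ x hx), div_lt_one (hρ x hx)]
      exact hs
    · rw [div_mul_cancel₀ _ (hρ x hx).ne']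

/-- Lipschitz tubular radii exist. Two normal segments of length less than `tubeRadius` that meet
have base points so close that both lie in one system of normal coordinates, which makes the normal
map globally injective; everything else is local. -/
theorem exists_lipschitz_isTubularRadius (hS : IsHypersurface ∞ S) (hν : IsUnitNormal S ν) :
    ∃ ρ : Eu n → ℝ, IsTubularRadius S ν ρ ∧ ∃ L : ℝ≥0, LipschitzOnWith L ρ S := by
  set A : Eu n → Set ℝ := fun x => {r | r ≤ 1 ∧ IsTubeSize S ν x r} with hA
  have hbdd : ∀ x, BddAbove (A x) := fun x => ⟨1, fun r hr => hr.1⟩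
  have hpos : ∀ x ∈ S, ∃ r ∈ A x, 0 < r := fun x hx => by
    obtain ⟨r, hr, h⟩ := hS.exists_isTubeSize hν hx
    exact ⟨min r 1, ⟨min_le_right _ _, h.mono (by simp)⟩, lt_min hr one_pos⟩
  have hρ : ∀ x, tubeRadius S ν x = sSup (A x) / 4 := fun x => rfl
  have hρpos : ∀ x ∈ S, 0 < tubeRadius S ν x := fun x hx => by
    obtain ⟨r, hr, hr0⟩ := hpos x hx
    rw [hρ]
    linarith [le_csSup (hbdd x) hr]
  have hlip : ∀ x ∈ S, ∀ y ∈ S, sSup (A x) ≤ sSup (A y) + dist x y := by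
    intro x hx y hy
    refine csSup_le ⟨_, (hpos x hx).choose_spec.1⟩ fun r hr => ?_
    have : r - dist x y ∈ A y :=
      ⟨by linarith [hr.1, dist_nonneg (x := x) (y := y)], hr.2.mono (by rw [dist_comm]; linarith)⟩
    linarith [le_csSup (hbdd y) this]
  have hL : LipschitzOnWith 1 (tubeRadius S ν) S := by
    refine LipschitzOnWith.of_dist_le_mul fun x hx y hy => ?_
    rw [Real.dist_eq, abs_le, hρ, hρ]
    have h1 := hlip x hx y hy
    have h2 := hlip y hy x hx
    have := dist_nonneg (x := x) (y := y)
    rw [dist_comm] at h2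
    push_cast
    constructor <;> linarith
  -- the factor `4` in `tubeRadius` leaves room for an admissible size above `2 * tubeRadius`
  have hloc : ∀ x ∈ S, ∃ O p s, IsOpen O ∧ ContDiffOn ℝ ∞ p O ∧ ContDiffOn ℝ ∞ s O ∧
      (∀ y ∈ O, p y ∈ S ∧ y = p y + s y • ν (p y)) ∧
      ∀ z ∈ S, tubeRadius S ν z ≤ tubeRadius S ν x → dist z x < 2 * tubeRadius S ν x → ∀ t : ℝ,
        |t| < tubeRadius S ν z →
        z + t • ν z ∈ O ∧ p (z + t • ν z) = z ∧ s (z + t • ν z) = t := by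
    intro x hx
    have h1 := hρpos x hx
    obtain ⟨r, hr, hr'⟩ := exists_lt_of_lt_csSup ⟨_, (hpos x hx).choose_spec.1⟩
      (show 2 * tubeRadius S ν x < sSup (A x) by rw [hρ] at h1 ⊢; linarith)
    obtain ⟨O, p, s, hO, hp, hs, hO', hz⟩ := hr.2
    exact ⟨O, p, s, hO, hp, hs, hO', fun z hzS hzx hd t ht =>
      hz z hzS (by linarith) t (by linarith)⟩
  have hinj : ∀ x ∈ S, ∀ y ∈ S, ∀ s t : ℝ, |s| < tubeRadius S ν x → |t| < tubeRadius S ν y →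
      x + s • ν x = y + t • ν y → x = y ∧ s = t := by
    have aux : ∀ x ∈ S, ∀ y ∈ S, ∀ s t : ℝ, |s| < tubeRadius S ν x → |t| < tubeRadius S ν y →
        tubeRadius S ν y ≤ tubeRadius S ν x →
        x + s • ν x = y + t • ν y → x = y ∧ s = t := by
      intro x hx y hy s t hs ht hyx h
      obtain ⟨O, p, s', -, -, -, -, hz⟩ := hloc x hx
      have hd : dist y x < 2 * tubeRadius S ν x := by
        have h1 : y - x = s • ν x - t • ν y := by
          rw [sub_eq_sub_iff_add_eq_add, ← h]; abel
        rw [dist_eq_norm, h1]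
        refine (norm_sub_le _ _).trans_lt ?_
        rw [norm_smul, norm_smul, (hν.2 x hx).1, (hν.2 y hy).1, Real.norm_eq_abs, Real.norm_eq_abs]
        linarith
      obtain ⟨-, hp1, hs1⟩ := hz x hx le_rfl (by simpa using hρpos x hx) s hs
      obtain ⟨-, hp2, hs2⟩ := hz y hy hyx hd t ht
      rw [h] at hp1 hs1
      exact ⟨hp1.symm.trans hp2, hs1.symm.trans hs2⟩
    intro x hx y hy s t hs ht h
    rcases le_total (tubeRadius S ν y) (tubeRadius S ν x) with h1 | h1
    · exact aux x hx y hy s t hs ht h1 h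
    · obtain ⟨h2, h3⟩ := aux y hy x hx t s ht hs h1 h.symm
      exact ⟨h2.symm, h3.symm⟩
  have hnear : ∀ y0 ∈ normalTube S ν (tubeRadius S ν), ∃ O p s, IsOpen O ∧ y0 ∈ O ∧
      ContDiffOn ℝ ∞ p O ∧ ContDiffOn ℝ ∞ s O ∧
      ∀ y ∈ O, p y ∈ S ∧ |s y| < tubeRadius S ν (p y) ∧ y = p y + s y • ν (p y) := by
    intro y0 hy0
    obtain ⟨x, hx, t, ht, rfl⟩ := (mem_normalTube_iff hρpos).1 hy0
    obtain ⟨O, p, s, hO, hp, hs, hO', hz⟩ := hloc x hx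
    obtain ⟨h0, hp0, hs0⟩ := hz x hx le_rfl (by simpa using hρpos x hx) t ht
    have hcont : ContinuousOn (fun y => tubeRadius S ν (p y) - |s y|) O :=
      (hL.continuousOn.comp hp.continuousOn fun y hy => (hO' y hy).1).sub hs.continuousOn.abs
    refine ⟨O ∩ (fun y => tubeRadius S ν (p y) - |s y|) ⁻¹' Ioi 0, p, s,
      hcont.isOpen_inter_preimage hO isOpen_Ioi, ⟨h0, ?_⟩, hp.mono inter_subset_left,
      hs.mono inter_subset_left, fun y hy => ⟨(hO' y hy.1).1, ?_, (hO' y hy.1).2⟩⟩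
    · simp only [mem_preimage, hp0, hs0, mem_Ioi]; linarith
    · have := hy.2
      simp only [mem_preimage, mem_Ioi] at this
      linarith
  refine ⟨tubeRadius S ν, ⟨hρpos, hL.continuousOn, ?_, ?_⟩, 1, hL⟩
  · rw [isOpen_iff_mem_nhds]
    intro y0 hy0
    obtain ⟨O, p, s, hO, hy0O, -, -, hO'⟩ := hnear y0 hy0
    filter_upwards [hO.mem_nhds hy0O] with y hy
    exact (mem_normalTube_iff hρpos).2 ⟨p y, (hO' y hy).1, s y, (hO' y hy).2⟩
  · have hex : ∀ y, ∃ w : Eu n × ℝ, y ∈ normalTube S ν (tubeRadius S ν) →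
        w.1 ∈ S ∧ |w.2| < tubeRadius S ν w.1 ∧ y = w.1 + w.2 • ν w.1 := by
      intro y
      by_cases hy : y ∈ normalTube S ν (tubeRadius S ν)
      · obtain ⟨x, hx, t, ht, h⟩ := (mem_normalTube_iff hρpos).1 hy
        exact ⟨(x, t), fun _ => ⟨hx, ht, h⟩⟩
      · exact ⟨0, fun h => absurd h hy⟩
    choose w hw using hex
    have hcongr : ∀ y0 ∈ normalTube S ν (tubeRadius S ν), ∃ p s, ContDiffAt ℝ ∞ p y0 ∧
        ContDiffAt ℝ ∞ s y0 ∧ (fun y => (w y).1) =ᶠ[𝓝 y0] p ∧ (fun y => (w y).2) =ᶠ[𝓝 y0] s := by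
      intro y0 hy0
      obtain ⟨O, p, s, hO, hy0O, hp, hs, hO'⟩ := hnear y0 hy0
      have key : ∀ y ∈ O, (w y).1 = p y ∧ (w y).2 = s y := fun y hy => by
        obtain ⟨h1, h2, h3⟩ := hO' y hy
        obtain ⟨h4, h5, h6⟩ := hw y ((mem_normalTube_iff hρpos).2 ⟨p y, h1, s y, h2, h3⟩)
        exact hinj _ h4 _ h1 _ _ h5 h2 (h6.symm.trans h3)
      refine ⟨p, s, hp.contDiffAt (hO.mem_nhds hy0O), hs.contDiffAt (hO.mem_nhds hy0O), ?_, ?_⟩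
      · filter_upwards [hO.mem_nhds hy0O] with y hy using (key y hy).1
      · filter_upwards [hO.mem_nhds hy0O] with y hy using (key y hy).2
    refine ⟨fun y => (w y).1, fun y => (w y).2, fun y hy => ?_, fun y hy => ?_,
      fun x hx t ht => ?_⟩
    · obtain ⟨p, s, hp, -, h, -⟩ := hcongr y hy
      exact (hp.congr_of_eventuallyEq h).contDiffWithinAt
    · obtain ⟨p, s, -, hs, -, h⟩ := hcongr y hy
      exact (hs.congr_of_eventuallyEq h).contDiffWithinAt
    · obtain ⟨h4, h5, h6⟩ := hw (x + t • ν x) ((mem_normalTube_iff hρpos).2 ⟨x, hx, t, ht, rfl⟩)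
      obtain ⟨h1, h2⟩ := hinj _ h4 _ hx _ _ h5 ht h6.symm
      exact ⟨h1, h2⟩

/-! ### Curvature bounds from a tubular radius -/

/-- A tubular neighborhood contains no focal points, so each eigenvalue `lam` of the shape
operator satisfies `|lam| ρ ≤ 1`: at the focal distance `-1 / lam` the normal map has a
degenerate differential. -/
theorem abs_eigenvalue_mul_le {ρ : Eu n → ℝ} (hρ : IsTubularRadius S ν ρ) (hx : x ∈ S)
    {D : Eu n →L[ℝ] Eu n} {O : Set (Eu n)} {τ : Eu n → Eu n} (hO : IsOpen O) (hxO : x ∈ O)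
    (hτS : MapsTo τ O S) (hτe : ∀ y ∈ S ∩ O, τ y = y)
    (hτd : HasFDerivAt τ (hyperplaneProj (ν x)) x) (hD : HasFDerivAt (ν ∘ τ) D x)
    {v : Eu n} (hv : v ≠ 0) (hvν : ⟪v, ν x⟫ = 0) {lam : ℝ} (hlam : D v = lam • v) :
    |lam| * ρ x ≤ 1 := by
  by_contra! hlt
  have hτx : τ x = x := hτe x ⟨hx, hxO⟩
  have hl0 : lam ≠ 0 := by rintro rfl; simp at hlt; linarith
  set s : ℝ := -lam⁻¹ with hs
  have hsρ : |s| < ρ x := by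
    rw [hs, abs_neg, abs_inv, inv_lt_iff_one_lt_mul₀ (abs_pos.2 hl0), mul_comm]
    exact hlt
  obtain ⟨p, s', hp, -, hps⟩ := hρ.exists_inverse
  have hy0 : x + s • ν x ∈ normalTube S ν ρ := (mem_normalTube_iff hρ.pos).2 ⟨x, hx, s, hsρ, rfl⟩
  have hpd := ((hp.contDiffAt (hρ.isOpen_tube.mem_nhds hy0)).differentiableAt
    (by simp)).hasFDerivAt
  set P := fderiv ℝ p (x + s • ν x) with hP
  have h1 : HasFDerivAt (fun y => τ y + s • (ν ∘ τ) y) (hyperplaneProj (ν x) + s • D) x :=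
    hτd.add (hD.const_smul s)
  have hpd' : HasFDerivAt p P (τ x + s • (ν ∘ τ) x) := by
    simpa only [Function.comp, hτx] using hpd
  have h2 := HasFDerivAt.comp (f := fun y => τ y + s • (ν ∘ τ) y) x hpd' h1
  have h3 : (p ∘ fun y => τ y + s • (ν ∘ τ) y) =ᶠ[𝓝 x] τ := by
    have hc : ContinuousAt (fun y => ρ (τ y)) x := by
      have : ContinuousWithinAt ρ S (τ x) := by rw [hτx]; exact hρ.continuousOn x hx
      have h4 : ContinuousWithinAt (ρ ∘ τ) O x := this.comp hτd.continuousAt.continuousWithinAt hτS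
      exact h4.continuousAt (hO.mem_nhds hxO)
    filter_upwards [hc.eventually (lt_mem_nhds (show |s| < ρ (τ x) by rw [hτx]; exact hsρ)), hO.mem_nhds hxO]
      with y hy hyO
    exact (hps (τ y) (hτS hyO) s hy).1
  have h5 := congrArg (fun A : Eu n →L[ℝ] Eu n => A v) (h2.unique (hτd.congr_of_eventuallyEq h3))
  simp only [ContinuousLinearMap.comp_apply, add_apply,
    smul_apply, hlam, hyperplaneProj_of_inner hvν, smul_smul] at h5
  rw [show s * lam = -1 by rw [hs]; field_simp] at h5
  simp at h5
  exact hv h5.symm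

/-- A symmetric operator all of whose eigenvalues are at most `c` in absolute value has norm at
most `c`. -/
theorem norm_le_of_abs_eigenvalue_le {E : Type*} [NormedAddCommGroup E] [InnerProductSpace ℝ E]
    [FiniteDimensional ℝ E] {D : E →L[ℝ] E} (hD : ∀ v w, ⟪D v, w⟫ = ⟪v, D w⟫) {c : ℝ} (hc : 0 ≤ c)
    (h : ∀ (lam : ℝ) (v : E), v ≠ 0 → D v = lam • v → |lam| ≤ c) : ‖D‖ ≤ c := by
  have hsym : (D : E →ₗ[ℝ] E).IsSymmetric := hD
  set b := hsym.eigenvectorBasis rfl with hb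
  set μ := hsym.eigenvalues rfl with hμ
  have hbμ : ∀ i, D (b i) = μ i • b i := fun i =>
    hsym.apply_eigenvectorBasis rfl i
  refine D.opNorm_le_bound hc fun v => ?_
  have h1 : ‖D v‖ ^ 2 ≤ (c * ‖v‖) ^ 2 := by
    rw [mul_pow, ← b.sum_sq_norm_inner_right (D v), ← b.sum_sq_norm_inner_right v, Finset.mul_sum]
    refine Finset.sum_le_sum fun i _ => ?_
    rw [← hD, hbμ, inner_smul_left, norm_mul, mul_pow]
    have h2 : |μ i| ≤ c := h _ _ (b.orthonormal.ne_zero i) (hbμ i)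
    have h3 : ‖μ i‖ ^ 2 ≤ c ^ 2 := pow_le_pow_left₀ (norm_nonneg _) h2 2
    simpa using mul_le_mul_of_nonneg_right h3 (sq_nonneg ‖⟪b i, v⟫‖)
  exact le_of_sq_le_sq h1 (by positivity)

/-- A tubular radius bounds all curvatures by its inverse: `ν` is Lipschitz with constant `2 / ρ(x)`
near `x`, and the principal curvatures at `x` are at most `1 / ρ(x)`. -/
theorem IsTubularRadius.curvature_bounds {ρ : Eu n → ℝ} (hρ : IsTubularRadius S ν ρ)
    (hS : IsHypersurface ∞ S) (hν : IsUnitNormal S ν) (hx : x ∈ S) :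
    (∃ U ∈ 𝓝[S] x, LipschitzOnWith (Real.toNNReal (2 / ρ x)) ν U) ∧
      curvatureNorm S ν x ≤ 1 / ρ x := by
  obtain ⟨D, O, τ, hO, hxO, hτS, hτe, hτd, hD, hDn, hDs⟩ := hS.exists_shapeOperator hν hx
  have hρx := hρ.pos x hx
  have hτx : τ x = x := hτe x ⟨hx, hxO⟩
  have heig : ∀ (lam : ℝ) (v : Eu n), v ≠ 0 → ⟪v, ν x⟫ = 0 → D v = lam • v → |lam| ≤ 1 / ρ x :=
    fun lam v hv hvν hl => by
      rw [le_div_iff₀ hρx]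
      exact abs_eigenvalue_mul_le hρ hx hO hxO hτS hτe hτd hD.hasFDerivAt hv hvν hl
  have hnorm : ‖D‖ ≤ 1 / ρ x := by
    refine norm_le_of_abs_eigenvalue_le hDs (by positivity) fun lam v hv hl => ?_
    rcases eq_or_ne lam 0 with rfl | hl0
    · simp only [abs_zero]; positivity
    · refine heig lam v hv ?_ hl
      have := hDn v
      rw [hl, inner_smul_left] at this
      simpa [hl0] using this
  constructor
  · obtain ⟨U, hU, hUL⟩ := hD.exists_lipschitzOnWith_of_nnnorm_lt (Real.toNNReal (2 / ρ x)) (by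
      rw [← NNReal.coe_lt_coe, coe_nnnorm, Real.coe_toNNReal _ (by positivity)]
      refine hnorm.trans_lt ?_
      gcongr; norm_num)
    refine ⟨S ∩ (U ∩ O), inter_mem self_mem_nhdsWithin
      (mem_nhdsWithin_of_mem_nhds (inter_mem hU (hO.mem_nhds hxO))), ?_⟩
    intro y hy z hz
    have := hUL hy.2.1 hz.2.1
    simpa only [Function.comp, hτe y ⟨hy.1, hy.2.2⟩, hτe z ⟨hz.1, hz.2.2⟩] using this
  · refine Real.sSup_le ?_ (by positivity)
    rintro _ ⟨κ, ⟨v, hv, hvν, hκ⟩, rfl⟩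
    have h1 : HasFDerivWithinAt ν D S x := by
      refine hD.hasFDerivAt.hasFDerivWithinAt.congr_of_eventuallyEq ?_ (by simp [hτx])
      filter_upwards [self_mem_nhdsWithin, mem_nhdsWithin_of_mem_nhds (hO.mem_nhds hxO)]
        with y hy hyO
      simp [hτe y ⟨hy, hyO⟩]
    have h2 : HasFDerivWithinAt ν (fderivWithin ℝ ν S x) S x :=
      ((hν.1.differentiableOn (by simp)) x hx).hasFDerivWithinAt
    have hvt : v ∈ tangentConeAt ℝ S x := by rw [(hν.2 x hx).2]; exact hvν
    have h3 : fderivWithin ℝ ν S x v = D v := h2.unique_on h1 hvt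
    rw [h3] at hκ
    rw [← abs_neg]
    refine heig (-κ) v hv hvν ?_
    rw [neg_smul, ← hκ, neg_neg]

end SoapFilm

namespace SoapFilm

variable {n : ℕ}

/-! ### One-sided layers in a tubular neighborhood -/

section Layer

variable {M M' : Set (Eu n)} {ν : Eu n → Eu n} {ρ u : Eu n → ℝ}

theorem IsTubularRadius.injective (hρ : IsTubularRadius M ν ρ) {x y : Eu n} (hx : x ∈ M)
    (hy : y ∈ M) {s t : ℝ} (hs : |s| < ρ x) (ht : |t| < ρ y) (h : x + s • ν x = y + t • ν y) :
    x = y ∧ s = t := by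
  obtain ⟨p, s', -, -, hps⟩ := hρ.exists_inverse
  obtain ⟨h1, h2⟩ := hps x hx s hs
  obtain ⟨h3, h4⟩ := hps y hy t ht
  rw [h] at h1 h2
  exact ⟨h1.symm.trans h3, h2.symm.trans h4⟩

theorem mem_oneSidedLayer_iff (hu : ∀ x ∈ M, 0 < u x) {y : Eu n} :
    y ∈ oneSidedLayer M ν u ↔ ∃ x ∈ M, ∃ s : ℝ, 0 < s ∧ s < u x ∧ y = x + s • ν x := by
  constructor
  · rintro ⟨x, hx, t, ht, ht1, rfl⟩
    exact ⟨x, hx, t * u x, mul_pos ht (hu x hx), mul_lt_of_lt_one_left (hu x hx) ht1, rfl⟩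
  · rintro ⟨x, hx, s, hs, hsu, rfl⟩
    refine ⟨x, hx, s / u x, div_pos hs (hu x hx), (div_lt_one (hu x hx)).2 hsu, ?_⟩
    rw [div_mul_cancel₀ _ (hu x hx).ne']

/-- Normal coordinates carry a relatively open condition on `(x, s)` to an open subset of the
tube. -/
theorem IsTubularRadius.isOpen_setOf (hρ : IsTubularRadius M ν ρ) {G : Set (Eu n)} (hG : IsOpen G)
    {a b : Eu n → ℝ} (ha : ContinuousOn a M) (hb : ContinuousOn b M)
    (hab : ∀ x ∈ M, ∀ s, a x < s → s < b x → |s| < ρ x) :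
    IsOpen {y | ∃ x ∈ M ∩ G, ∃ s : ℝ, a x < s ∧ s < b x ∧ y = x + s • ν x} := by
  obtain ⟨p, s', hp, hs', hps⟩ := hρ.exists_inverse
  have hpM : MapsTo p (normalTube M ν ρ) M := fun y hy => by
    obtain ⟨x, hx, t, ht, rfl⟩ := (mem_normalTube_iff hρ.pos).1 hy
    rwa [(hps x hx t ht).1]
  have h1 : ContinuousOn (fun y => (p y, s' y - a (p y), b (p y) - s' y)) (normalTube M ν ρ) :=
    hp.continuousOn.prodMk ((hs'.continuousOn.sub (ha.comp hp.continuousOn hpM)).prodMk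
      ((hb.comp hp.continuousOn hpM).sub hs'.continuousOn))
  have h2 := h1.isOpen_inter_preimage hρ.isOpen_tube
    (hG.prod ((isOpen_Ioi (a := (0 : ℝ))).prod (isOpen_Ioi (a := (0 : ℝ)))))
  convert h2 using 1
  ext y
  constructor
  · rintro ⟨x, ⟨hx, hxG⟩, s, hs1, hs2, rfl⟩
    have h3 := hab x hx s hs1 hs2
    refine ⟨(mem_normalTube_iff hρ.pos).2 ⟨x, hx, s, h3, rfl⟩, ?_⟩
    obtain ⟨h4, h5⟩ := hps x hx s h3
    simp only [mem_preimage, h4, h5, mem_prod, mem_Ioi]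
    exact ⟨hxG, by linarith, by linarith⟩
  · rintro ⟨hy, hy'⟩
    obtain ⟨x, hx, s, hs, rfl⟩ := (mem_normalTube_iff hρ.pos).1 hy
    obtain ⟨h4, h5⟩ := hps x hx s hs
    simp only [mem_preimage, h4, h5, mem_prod, mem_Ioi] at hy'
    exact ⟨x, ⟨hx, hy'.1⟩, s, by linarith [hy'.2.1], by linarith [hy'.2.2], rfl⟩

/-- A thickness function for the layers over `M`: positive, smaller than the tubular radius, and
at most half the distance to the set `Z` to which `M` may accumulate. -/
structure IsThickness (M Z : Set (Eu n)) (ν : Eu n → Eu n) (ρ u : Eu n → ℝ) : Prop where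
  tubular : IsTubularRadius M ν ρ
  norm_normal : ∀ x ∈ M, ‖ν x‖ = 1
  continuousOn_normal : ContinuousOn ν M
  pos : ∀ x ∈ M, 0 < u x
  le_one : ∀ x ∈ M, u x ≤ 1
  lt_radius : ∀ x ∈ M, u x < ρ x
  two_mul_le_dist : ∀ x ∈ M, ∀ z ∈ Z, 2 * u x ≤ dist x z
  continuousOn : ContinuousOn u M

variable {Z : Set (Eu n)}

theorem IsThickness.dist_add_smul (h : IsThickness M Z ν ρ u) {x : Eu n} (hx : x ∈ M) {s : ℝ}
    (hs : 0 ≤ s) : dist (x + s • ν x) x = s := by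
  rw [dist_eq_norm, add_sub_cancel_left, norm_smul, h.norm_normal x hx, Real.norm_eq_abs,
    abs_of_nonneg hs, mul_one]

theorem IsThickness.isOpen_layer (h : IsThickness M Z ν ρ u) {G : Set (Eu n)} (hG : IsOpen G) :
    IsOpen (oneSidedLayer (M ∩ G) ν u) := by
  convert h.tubular.isOpen_setOf hG continuousOn_const (a := fun _ => 0) h.continuousOn ?_ using 1
  · ext y
    exact mem_oneSidedLayer_iff fun x hx => h.pos x hx.1
  · intro x hx s h0 hs
    rw [abs_of_pos h0]; exact hs.trans (h.lt_radius x hx)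

/-- A layer does not meet `Z`. -/
theorem IsThickness.disjoint_layer (h : IsThickness M Z ν ρ u) :
    Disjoint (oneSidedLayer M ν u) Z := by
  rw [disjoint_left]
  intro y hy hyZ
  obtain ⟨x, hx, s, hs0, hs, rfl⟩ := (mem_oneSidedLayer_iff h.pos).1 hy
  have h1 := h.two_mul_le_dist x hx _ hyZ
  rw [dist_comm, h.dist_add_smul hx hs0.le] at h1
  linarith

/-- A layer does not meet `M`. -/
theorem IsThickness.disjoint_layer_self (h : IsThickness M Z ν ρ u) :
    Disjoint (oneSidedLayer M ν u) M := by
  rw [disjoint_left]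
  intro y hy hyM
  obtain ⟨x, hx, s, hs0, hs, hxy⟩ := (mem_oneSidedLayer_iff h.pos).1 hy
  have h1 := h.tubular.injective (s := 0) hyM hx (by simpa using h.tubular.pos y hyM)
    (by rw [abs_of_pos hs0]; exact hs.trans (h.lt_radius x hx)) (by simpa using hxy)
  linarith [h1.2]

theorem IsThickness.subset_closure_layer (h : IsThickness M Z ν ρ u) (hM' : M' ⊆ M) :
    M' ⊆ closure (oneSidedLayer M' ν u) := by
  intro x hx
  rw [Metric.mem_closure_iff]
  intro ε hε
  have h0 := h.pos x (hM' hx)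
  have h1 : 0 < min (u x) ε / 2 := by positivity
  refine ⟨x + (min (u x) ε / 2) • ν x, (mem_oneSidedLayer_iff fun x hx => h.pos x (hM' hx)).2
    ⟨x, hx, _, h1, ?_, rfl⟩, ?_⟩
  · linarith [min_le_left (u x) ε]
  · rw [dist_comm, h.dist_add_smul (hM' hx) h1.le]
    linarith [min_le_right (u x) ε]

/-- Limits of points of a layer lie in the layer, on the graph of `u`, or in the closure of the
base: where the base points leave `M` they approach `Z`, and there the thickness tends to zero. -/
theorem IsThickness.closure_layer_subset (h : IsThickness M Z ν ρ u) (hM' : M' ⊆ M)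
    (hcl : M ∩ closure M' ⊆ M') (hZ : closure M \ M ⊆ Z) :
    closure (oneSidedLayer M' ν u) ⊆
      oneSidedLayer M' ν u ∪ (M ∪ closure M ∩ Z) ∪ (fun x => x + u x • ν x) '' M := by
  intro y hy
  obtain ⟨w, hw, hwy⟩ := mem_closure_iff_seq_limit.1 hy
  have hmem : ∀ j, ∃ x ∈ M', ∃ s : ℝ, 0 < s ∧ s < u x ∧ w j = x + s • ν x := fun j =>
    (mem_oneSidedLayer_iff fun x hx => h.pos x (hM' hx)).1 (hw j)
  choose x hx s hs0 hsu hwx using hmem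
  have hdist : ∀ j, dist (w j) (x j) = s j := fun j => by
    rw [hwx, h.dist_add_smul (hM' (hx j)) (hs0 j).le]
  have hs1 : ∀ j, s j ≤ 1 := fun j => (hsu j).le.trans (h.le_one _ (hM' (hx j)))
  obtain ⟨R, hR⟩ := (Metric.isBounded_range_of_tendsto w hwy).subset_closedBall y
  have hcpt : IsCompact (closedBall y (R + 1) ×ˢ Icc (0 : ℝ) 1) :=
    (isCompact_closedBall _ _).prod isCompact_Icc
  have hin : ∀ j, (x j, s j) ∈ closedBall y (R + 1) ×ˢ Icc (0 : ℝ) 1 := fun j => by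
    refine ⟨?_, (hs0 j).le, hs1 j⟩
    have h1 : dist (w j) y ≤ R := hR ⟨j, rfl⟩
    have h2 := dist_triangle (x j) (w j) y
    rw [dist_comm (x j) (w j), hdist] at h2
    exact mem_closedBall.2 (show dist (x j) y ≤ R + 1 by linarith [hs1 j])
  obtain ⟨⟨a, t⟩, -, φ, hφ, hlim⟩ := hcpt.tendsto_subseq hin
  have hxa : Tendsto (fun j => x (φ j)) atTop (𝓝 a) := (continuous_fst.tendsto _).comp hlim
  have hst : Tendsto (fun j => s (φ j)) atTop (𝓝 t) := (continuous_snd.tendsto _).comp hlim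
  have hwy' : Tendsto (fun j => w (φ j)) atTop (𝓝 y) := hwy.comp hφ.tendsto_atTop
  have haM' : a ∈ closure M' := mem_closure_of_tendsto hxa (Eventually.of_forall fun j => hx _)
  have haM : a ∈ closure M := closure_mono hM' haM'
  by_cases haZ : a ∈ Z
  · -- the thickness, hence `s`, tends to zero along the sequence
    have h1 : Tendsto (fun j => dist (x (φ j)) a) atTop (𝓝 0) := by
      simpa using hxa.dist (tendsto_const_nhds (x := a))
    have h2 : Tendsto (fun j => dist (w (φ j)) (x (φ j))) atTop (𝓝 0) := by
      refine squeeze_zero (fun _ => dist_nonneg) (fun j => ?_) h1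
      have := h.two_mul_le_dist _ (hM' (hx (φ j))) a haZ
      rw [hdist]
      linarith [hsu (φ j), h.pos _ (hM' (hx (φ j)))]
    have h3 : dist y a = 0 := tendsto_nhds_unique (hwy'.dist hxa) h2
    rw [dist_eq_zero] at h3
    exact Or.inl (Or.inr (Or.inr (by rw [h3]; exact ⟨haM, haZ⟩)))
  · have haM1 : a ∈ M := by
      by_contra hn
      exact haZ (hZ ⟨haM, hn⟩)
    have haM2 : a ∈ M' := hcl ⟨haM1, haM'⟩
    have hxw : Tendsto (fun j => x (φ j)) atTop (𝓝[M] a) :=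
      tendsto_nhdsWithin_iff.2 ⟨hxa, Eventually.of_forall fun j => hM' (hx _)⟩
    have hν := (h.continuousOn_normal a haM1).tendsto.comp hxw
    have hu := (h.continuousOn a haM1).tendsto.comp hxw
    have hy' : y = a + t • ν a := by
      refine tendsto_nhds_unique hwy' ?_
      simp_rw [hwx]
      exact hxa.add (hst.smul hν)
    have ht0 : 0 ≤ t := ge_of_tendsto' hst fun j => (hs0 _).le
    have htu : t ≤ u a := le_of_tendsto_of_tendsto' hst hu fun j => (hsu _).le
    rcases ht0.eq_or_lt with rfl | ht0
    · exact Or.inl (Or.inr (Or.inl (by simpa [hy'] using haM1)))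
    rcases htu.eq_or_lt with rfl | htu
    · exact Or.inr ⟨a, haM1, hy'.symm⟩
    · exact Or.inl (Or.inl ((mem_oneSidedLayer_iff fun x hx => h.pos x (hM' hx)).2
        ⟨a, haM2, t, ht0, htu, hy'⟩))

/-- Points of `M` are limits of points on the side of `M` opposite to the layer, and these are at
positive distance from the layer. -/
theorem IsThickness.mem_closure_diff_closure_layer (h : IsThickness M Z ν ρ u) {E : Set (Eu n)}
    (hE : IsOpen E) (hM' : M' ⊆ M) {x : Eu n} (hx : x ∈ M) (hxE : x ∈ E) :
    x ∈ closure (E \ closure (oneSidedLayer M' ν u)) := by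
  rw [Metric.mem_closure_iff]
  intro ε hε
  obtain ⟨r, hr, hrE⟩ := Metric.isOpen_iff.1 hE x hxE
  have hρx := h.tubular.pos x hx
  set t := min (min r ε) (ρ x) / 2 with ht
  have ht0 : 0 < t := by positivity
  have htr : t < r := by linarith [min_le_left (min r ε) (ρ x), min_le_left r ε]
  have htε : t < ε := by linarith [min_le_left (min r ε) (ρ x), min_le_right r ε]
  have htρ : t < ρ x := by linarith [min_le_right (min r ε) (ρ x)]
  have hd : dist (x + (-t) • ν x) x = t := by
    rw [dist_eq_norm, add_sub_cancel_left, norm_smul, h.norm_normal x hx, Real.norm_eq_abs,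
      abs_neg, abs_of_pos ht0, mul_one]
  refine ⟨x + (-t) • ν x, ⟨hrE (by rw [mem_ball, hd]; exact htr), ?_⟩,
    by rw [dist_comm, hd]; exact htε⟩
  have hopen := h.tubular.isOpen_setOf isOpen_univ (a := fun x => -ρ x) (b := fun _ => 0)
    h.tubular.continuousOn.neg continuousOn_const (fun x _ s h1 h2 => by
      rw [abs_of_neg h2]; linarith)
  intro hcl
  obtain ⟨y, ⟨x1, ⟨hx1, -⟩, s1, hs1, hs1', rfl⟩, hy2⟩ := mem_closure_iff.1 hcl _ hopen
    ⟨x, ⟨hx, trivial⟩, -t, by linarith, by linarith, rfl⟩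
  obtain ⟨x2, hx2, s2, hs2, hs2', he⟩ :=
    (mem_oneSidedLayer_iff fun x hx => h.pos x (hM' hx)).1 hy2
  have := h.tubular.injective hx1 (hM' hx2) (by rw [abs_of_neg hs1']; linarith)
    (by rw [abs_of_pos hs2]; exact hs2'.trans (h.lt_radius _ (hM' hx2))) he
  linarith [this.2]

end Layer

/-! ### The topology of the opened set -/

section Opened

variable {W K S E : Set (Eu n)} {ν : Eu n → Eu n} {ρ u : Eu n → ℝ}

theorem collapsedExt_eq : collapsedExt K S E = collapsed K S E ∩ (closure E)ᶜ := by
  ext x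
  simp only [collapsed, collapsedExt, collapsedInt, mem_inter_iff, mem_union, Set.mem_sdiff,
    mem_compl_iff]
  have := @subset_closure _ _ E x
  tauto

theorem collapsedInt_eq : collapsedInt K S E = collapsed K S E ∩ E := by
  ext x
  simp only [collapsed, collapsedExt, collapsedInt, mem_inter_iff, mem_union, Set.mem_sdiff]
  have := @subset_closure _ _ E x
  tauto

theorem collapsed_eq (hE : IsOpen E) : collapsed K S E = (K \ S) \ frontier E := by
  ext x
  simp only [collapsed, collapsedExt, collapsedInt, mem_inter_iff, mem_union, Set.mem_sdiff,
    hE.frontier_eq]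
  have := @subset_closure _ _ E x
  tauto

/-- The opened set for a general thickness function. -/
def openedWith (K S E : Set (Eu n)) (ν : Eu n → Eu n) (u : Eu n → ℝ) : Set (Eu n) :=
  oneSidedLayer (collapsedExt K S E) ν u ∪ (E \ closure (oneSidedLayer (collapsedInt K S E) ν u))

variable (h : IsThickness (collapsed K S E) (S ∪ frontier E ∪ W) ν ρ u)

include h

theorem IsThickness.openedWith_subset (hEW : E ⊆ Wᶜ) : openedWith K S E ν u ⊆ Wᶜ := by
  rintro y (hy | hy)
  · intro hyW
    obtain ⟨x, hx, hx'⟩ := hy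
    exact disjoint_left.1 h.disjoint_layer ⟨x, Or.inl hx, hx'⟩ (Or.inr hyW)
  · exact hEW hy.1

theorem IsThickness.isOpen_openedWith (hE : IsOpen E) : IsOpen (openedWith K S E ν u) := by
  refine IsOpen.union ?_ (hE.sdiff isClosed_closure)
  rw [collapsedExt_eq]
  exact h.isOpen_layer isClosed_closure.isOpen_compl

theorem IsThickness.subset_frontier_openedWith (hE : IsOpen E)
    (hS : ∀ U : Set (Eu n), IsOpen U → K ∩ U ⊆ S → K ∩ U = ∅) :
    K ⊆ frontier (openedWith K S E ν u) := by
  have h0 : collapsedExt K S E ⊆ collapsed K S E := subset_union_left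
  have h1 : collapsedInt K S E ⊆ collapsed K S E := subset_union_right
  have hF := h.isOpen_openedWith hE
  have hA0 : ∀ y, y ∈ oneSidedLayer (collapsedExt K S E) ν u →
      y ∈ oneSidedLayer (collapsed K S E) ν u := by
    rintro y ⟨x, hx, hx'⟩
    exact ⟨x, h0 hx, hx'⟩
  have hext : collapsedExt K S E ⊆ frontier (openedWith K S E ν u) := by
    intro x hx
    rw [hF.frontier_eq]
    refine ⟨closure_mono subset_union_left (h.subset_closure_layer h0 hx), ?_⟩
    rintro (h2 | h2)
    · exact disjoint_left.1 h.disjoint_layer_self (hA0 x h2) (h0 hx)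
    · exact hx.2 (subset_closure h2.1)
  have hint : collapsedInt K S E ⊆ frontier (openedWith K S E ν u) := by
    intro x hx
    rw [hF.frontier_eq]
    refine ⟨closure_mono subset_union_right
      (h.mem_closure_diff_closure_layer hE h1 (h1 hx) hx.2), ?_⟩
    rintro (h2 | h2)
    · exact disjoint_left.1 h.disjoint_layer_self (hA0 x h2) (h1 hx)
    · exact h2.2 (h.subset_closure_layer h1 hx)
  have hbd : (K \ S) ∩ frontier E ⊆ frontier (openedWith K S E ν u) := by
    rintro x ⟨hxK, hxE⟩
    rw [hF.frontier_eq]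
    constructor
    swap
    · rintro (h2 | h2)
      · exact disjoint_left.1 h.disjoint_layer (hA0 x h2) (Or.inl (Or.inr hxE))
      · exact (hE.frontier_eq ▸ hxE : x ∈ closure E \ E).2 h2.1
    by_contra hx
    -- otherwise, near `x`, all of `E` lies in the closure of the inner layer; the base points of
    -- that layer are then close to `x` as well, since the thickness is controlled by the distance
    obtain ⟨r, hr, hrF⟩ := Metric.isOpen_iff.1 (isClosed_closure (s := openedWith K S E ν u)
      ).isOpen_compl x hx
    have hxE' : x ∈ closure E := frontier_subset_closure hxE
    obtain ⟨z, hzE, hz⟩ := Metric.mem_closure_iff.1 hxE' (r / 4) (by positivity)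
    have hzcl : z ∈ closure (oneSidedLayer (collapsedInt K S E) ν u) := by
      by_contra hn
      refine hrF (show z ∈ ball x r by rw [mem_ball, dist_comm]; linarith)
        (subset_closure (Or.inr ⟨hzE, hn⟩))
    obtain ⟨y, hy, hzy⟩ := Metric.mem_closure_iff.1 hzcl (r / 4) (by positivity)
    obtain ⟨a, ha, s, hs0, hs, rfl⟩ := (mem_oneSidedLayer_iff fun x hx => h.pos x (h1 hx)).1 hy
    have h2 := h.two_mul_le_dist a (h1 ha) x (Or.inl (Or.inr hxE))
    have h3 := h.dist_add_smul (h1 ha) hs0.le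
    have h4 : dist a x < r := by
      have h5 := dist_triangle4 a (a + s • ν a) z x
      rw [dist_comm a (a + s • ν a), dist_comm _ z, dist_comm z x] at h5
      linarith
    exact hrF (mem_ball.2 h4) (frontier_subset_closure (hint ha))
  have hKS : K \ S ⊆ frontier (openedWith K S E ν u) := by
    intro x hx
    by_cases hxE : x ∈ frontier E
    · exact hbd ⟨hx, hxE⟩
    · have hx' : x ∈ collapsed K S E := by rw [collapsed_eq hE]; exact ⟨hx, hxE⟩
      rcases hx' with hx' | hx'
      exacts [hext hx', hint hx']
  intro x hx
  by_contra hn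
  have h2 : K ∩ (frontier (openedWith K S E ν u))ᶜ ⊆ S := fun y hy => by
    by_contra hyS
    exact hy.2 (hKS ⟨hy.1, hyS⟩)
  have h3 := hS _ isClosed_frontier.isOpen_compl h2
  exact (h3 ▸ (⟨hx, hn⟩ : x ∈ K ∩ (frontier (openedWith K S E ν u))ᶜ) : x ∈ (∅ : Set (Eu n)))

theorem IsThickness.frontier_openedWith_subset (hE : IsOpen E) (hK : Wᶜ ∩ closure K ⊆ K)
    (hEK : Wᶜ ∩ frontier E ⊆ K) :
    Wᶜ ∩ frontier (openedWith K S E ν u) ⊆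
      K ∪ (fun x => x + u x • ν x) '' collapsed K S E := by
  have h0 : collapsedExt K S E ⊆ collapsed K S E := subset_union_left
  have h1 : collapsedInt K S E ⊆ collapsed K S E := subset_union_right
  have hMK : collapsed K S E ⊆ K := by
    rw [collapsed_eq hE]; exact fun x hx => hx.1.1
  have hF := h.isOpen_openedWith hE
  have hclM : closure (collapsed K S E) \ collapsed K S E ⊆ S ∪ frontier E ∪ W := by
    rintro x ⟨hx, hxM⟩
    by_contra hn
    simp only [mem_union, not_or] at hn
    refine hxM ?_
    rw [collapsed_eq hE]
    exact ⟨⟨hK ⟨hn.2, closure_mono hMK hx⟩, hn.1.1⟩, hn.1.2⟩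
  have hlayer : ∀ M' : Set (Eu n), M' ⊆ collapsed K S E → collapsed K S E ∩ closure M' ⊆ M' →
      ∀ y, y ∉ W → y ∈ closure (oneSidedLayer M' ν u) → y ∉ oneSidedLayer M' ν u →
      y ∈ K ∪ (fun x => x + u x • ν x) '' collapsed K S E := by
    intro M' hM' hcl y hyW hy hyn
    rcases h.closure_layer_subset hM' hcl hclM hy with (h2 | h2 | h2) | h2
    · exact absurd h2 hyn
    · exact Or.inl (hMK h2)
    · exact Or.inl (hK ⟨hyW, closure_mono hMK h2.1⟩)
    · exact Or.inr h2
  have hcl0 : collapsed K S E ∩ closure (collapsedExt K S E) ⊆ collapsedExt K S E := by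
    rintro x ⟨hx | hx, hx'⟩
    · exact hx
    · obtain ⟨y, hyE, hy⟩ := mem_closure_iff.1 hx' E hE hx.2
      exact absurd (subset_closure hyE) hy.2
  have hcl1 : collapsed K S E ∩ closure (collapsedInt K S E) ⊆ collapsedInt K S E := by
    rintro x ⟨hx | hx, hx'⟩
    · exact absurd (closure_mono inter_subset_right hx') hx.2
    · exact hx
  rintro y ⟨hyW, hy⟩
  rw [hF.frontier_eq] at hy
  obtain ⟨hyc, hyF⟩ := hy
  have hyc' : y ∈ closure (oneSidedLayer (collapsedExt K S E) ν u) ∪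
      closure (E \ closure (oneSidedLayer (collapsedInt K S E) ν u)) := by
    rwa [← closure_union]
  by_cases hy0 : y ∈ closure (oneSidedLayer (collapsedExt K S E) ν u)
  · exact hlayer _ h0 hcl0 y hyW hy0 fun h2 => hyF (Or.inl h2)
  have hy1 := hyc'.resolve_left hy0
  have hyE' : y ∈ closure E := closure_mono sdiff_subset hy1
  by_cases hyE : y ∈ E
  · have hy2 : y ∈ closure (oneSidedLayer (collapsedInt K S E) ν u) := by
      by_contra hn
      exact hyF (Or.inr ⟨hyE, hn⟩)
    refine hlayer _ h1 hcl1 y hyW hy2 fun h2 => ?_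
    -- the inner layer is an open set disjoint from `E \ closure (inner layer)`
    rw [collapsedInt_eq] at h2
    obtain ⟨w, hw, hw'⟩ := mem_closure_iff.1 hy1 _ (h.isOpen_layer hE) h2
    rw [← collapsedInt_eq] at hw
    exact hw'.2 (subset_closure hw)
  · exact Or.inl (hEK ⟨hyW, by rw [hE.frontier_eq]; exact ⟨hyE', hyE⟩⟩)

end Opened

end SoapFilm

namespace SoapFilm

variable {n : ℕ}

/-! ### Rectifiability of compact hypersurfaces -/

theorem exists_linearIsometry_orthogonal {N : Eu n} (hN : N ≠ 0) :
    ∃ ι : EuclideanSpace ℝ (Fin n) →ₗᵢ[ℝ] Eu n, ∀ v : Eu n, ⟪v, N⟫ = 0 → ∃ w, ι w = v := by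
  have : Fact (Module.finrank ℝ (Eu n) = n + 1) := ⟨by simp⟩
  let b := OrthonormalBasis.fromOrthogonalSpanSingleton (𝕜 := ℝ) n hN
  refine ⟨(Submodule.subtypeₗᵢ _).comp b.repr.symm.toLinearIsometry, fun v hv => ?_⟩
  have hv' : v ∈ (Submodule.span ℝ {N})ᗮ :=
    Submodule.mem_orthogonal_singleton_iff_inner_left.2 hv
  exact ⟨b.repr ⟨v, hv'⟩, by simp⟩

/-- Near each of its points, a `C^k` hypersurface (`k ≥ 1`) is contained in a Lipschitz image of a
ball of `ℝ^n`. -/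
theorem IsHypersurface.exists_lipschitz_param {k : WithTop ℕ∞} (hk : 1 ≤ k) {S : Set (Eu n)}
    (hS : IsHypersurface k S) {x : Eu n} (hx : x ∈ S) :
    ∃ O ∈ 𝓝 x, ∃ (g : EuclideanSpace ℝ (Fin n) → Eu n) (L : ℝ≥0) (r : ℝ), LipschitzWith L g ∧
      S ∩ O ⊆ g '' closedBall 0 r := by
  obtain ⟨N, e, hN, hxe, hex, he, hes, -, hSe⟩ := hS.exists_chart hk hx
  have hxt : x ∈ e.target := by simpa [hex] using e.map_source hxe
  obtain ⟨c, t, ht, hc⟩ := ((hes.contDiffAt (e.open_target.mem_nhds hxt)).of_le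
    hk).exists_lipschitzOnWith
  obtain ⟨ι, hι⟩ := exists_linearIsometry_orthogonal hN
  set j : EuclideanSpace ℝ (Fin n) → Eu n := fun w => x + ι w with hj
  have hjL : LipschitzWith 1 j := by
    refine LipschitzWith.of_dist_le_mul fun v w => ?_
    simp [hj, ι.dist_map]
  obtain ⟨r, hr, hrt⟩ := Metric.mem_nhds_iff.1 ht
  have hL : LipschitzOnWith (c * 1) (e.symm ∘ j) (j ⁻¹' t) :=
    hc.comp hjL.lipschitzOnWith fun w hw => hw
  obtain ⟨g, hg, hge⟩ : ∃ g, LipschitzWith _ g ∧ EqOn (e.symm ∘ j) g (j ⁻¹' t) :=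
    hL.extend_finite_dimension
  have hO : e.source ∩ e ⁻¹' ball x r ∈ 𝓝 x :=
    (e.isOpen_inter_preimage isOpen_ball).mem_nhds ⟨hxe, by simp [hex, hr]⟩
  refine ⟨_, hO, g, _, r, hg, ?_⟩
  rintro y ⟨hyS, hye, hyr⟩
  rw [mem_preimage, mem_ball] at hyr
  obtain ⟨v, hv⟩ := hι (e y - x) ((hSe y hye).1 hyS)
  have hjy : j v = e y := by simp [hj, hv]
  refine ⟨v, ?_, ?_⟩
  · rw [mem_closedBall_zero_iff, ← ι.norm_map, hv, ← dist_eq_norm]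
    exact hyr.le
  · have hvt : j v ∈ t := by rw [hjy]; exact hrt hyr
    have hgv : e.symm (j v) = g v := hge hvt
    rw [← hgv, hjy, e.left_inv hye]

theorem IsHypersurface.rectifiable_of_isCompact {k : WithTop ℕ∞} (hk : 1 ≤ k) {S : Set (Eu n)}
    (hS : IsHypersurface k S) (hc : IsCompact S) :
    HasLipschitzCover n S ∧ hausdorff n S < ⊤ := by
  refine hc.induction_on (p := fun T => HasLipschitzCover n T ∧ hausdorff n T < ⊤)
    ⟨⟨fun _ _ => 0, fun _ => ⟨0, LipschitzWith.const _⟩, by simp⟩, by simp⟩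
    (fun s t hst ht => ⟨ht.1.mono hst, (measure_mono hst).trans_lt ht.2⟩)
    (fun s t hs ht => ⟨hs.1.union ht.1,
      (measure_union_le _ _).trans_lt (ENNReal.add_lt_top.2 ⟨hs.2, ht.2⟩)⟩) fun x hx => ?_
  obtain ⟨O, hO, g, L, r, hg, hSO⟩ := hS.exists_lipschitz_param hk hx
  refine ⟨S ∩ O, inter_mem self_mem_nhdsWithin (mem_nhdsWithin_of_mem_nhds hO), ?_, ?_⟩
  · refine ⟨fun _ => g, fun _ => ⟨L, hg⟩, ?_⟩
    rw [sdiff_eq_empty.2, measure_empty]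
    exact hSO.trans ((image_subset_range _ _).trans (subset_iUnion (fun _ : ℕ => range g) 0))
  · refine (measure_mono hSO).trans_lt ((euclideanHausdorffMeasure_image_le
      hg.lipschitzOnWith n).trans_lt ?_)
    rw [EuclideanSpace.euclideanHausdorffMeasure_eq_volume]
    exact ENNReal.mul_lt_top (by simp) (isCompact_closedBall _ _).measure_lt_top

/-! ### The area of the graph over `M` -/

section Graph

variable {M : Set (Eu n)} {ν : Eu n → Eu n} {ρ w : Eu n → ℝ}

theorem lipschitzOnWith_graph {U : Set (Eu n)} {a : Eu n → ℝ} {A : ℝ} {l B : ℝ≥0}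
    (hν : ∀ x ∈ U, ‖ν x‖ = 1) (hνL : LipschitzOnWith B ν U) (haL : LipschitzOnWith l a U)
    (haA : ∀ x ∈ U, |a x| ≤ A) {c : ℝ≥0} (hc : 1 + l + A * B ≤ c) :
    LipschitzOnWith c (fun x => x + a x • ν x) U := by
  refine LipschitzOnWith.of_dist_le_mul fun x hx y hy => ?_
  have h1 : (x + a x • ν x) - (y + a y • ν y) =
      (x - y) + ((a x - a y) • ν x + a y • (ν x - ν y)) := by
    rw [sub_smul, smul_sub]; abel
  have h2 : |a x - a y| ≤ l * dist x y := by simpa [Real.dist_eq] using haL.dist_le_mul x hx y hy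
  have h3 : ‖ν x - ν y‖ ≤ B * dist x y := by
    simpa [dist_eq_norm] using hνL.dist_le_mul x hx y hy
  rw [dist_eq_norm, h1]
  refine (norm_add_le _ _).trans ((add_le_add_right (norm_add_le _ _) _).trans ?_)
  rw [norm_smul, norm_smul, hν x hx, Real.norm_eq_abs, Real.norm_eq_abs, ← dist_eq_norm]
  calc dist x y + (|a x - a y| * 1 + |a y| * ‖ν x - ν y‖)
      ≤ dist x y + (l * dist x y + A * (B * dist x y)) := by
        rw [mul_one]
        gcongr
        · exact (abs_nonneg _).trans (haA y hy)
        · exact haA y hy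
    _ = (1 + l + A * B) * dist x y := by ring
    _ ≤ c * dist x y := by gcongr

variable (hρ : IsTubularRadius M ν ρ) (hM : IsHypersurface ∞ M) (hν : IsUnitNormal M ν)
  {L : ℝ≥0} (hwL : LipschitzOnWith L w M)

include hρ hM hν hwL

/-- The graph map has locally a Lipschitz constant that does not depend on the height `η`, since
the Lipschitz constant of `ν` near `x` is controlled by the inverse of the tubular radius. -/
theorem exists_lipschitzOnWith_graph (hwρ : ∀ x ∈ M, w x ≤ ρ x) (hw0 : ∀ x ∈ M, 0 < w x)
    {η : ℝ} (hη : 0 < η) {x : Eu n} (hx : x ∈ M) :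
    ∃ U ∈ 𝓝[M] x, LipschitzOnWith (5 + L) (fun x => x + min η (w x) • ν x) U := by
  obtain ⟨⟨U, hU, hUL⟩, -⟩ := hρ.curvature_bounds hM hν hx
  have hρx := hρ.pos x hx
  have h1 : ∀ᶠ y in 𝓝[M] x, w y < 2 * ρ x :=
    (hwL.continuousOn x hx).eventually (gt_mem_nhds (by linarith [hwρ x hx]))
  refine ⟨{y | y ∈ M ∧ y ∈ U ∧ w y < 2 * ρ x},
    (eventually_mem_nhdsWithin (s := M)).and ((show ∀ᶠ y in 𝓝[M] x, y ∈ U from hU).and h1), ?_⟩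
  refine lipschitzOnWith_graph (A := 2 * ρ x) (l := L) (fun y hy => (hν.2 y hy.1).1)
    (hUL.mono fun y hy => hy.2.1) ?_ ?_ ?_
  · refine LipschitzOnWith.of_dist_le_mul fun y hy z hz => ?_
    rw [Real.dist_eq]
    refine (abs_min_sub_min_le_max _ _ _ _).trans ?_
    rw [sub_self, abs_zero, max_eq_right (abs_nonneg _), ← Real.dist_eq]
    exact hwL.dist_le_mul y hy.1 z hz.1
  · intro y hy
    rw [abs_of_pos (lt_min hη (hw0 y hy.1))]
    exact (min_le_right _ _).trans hy.2.2.le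
  · rw [Real.coe_toNNReal _ (by positivity)]
    have : 2 * ρ x * (2 / ρ x) = 4 := by field_simp; norm_num
    rw [this]; push_cast; linarith

/-- Where the height is constantly `η`, small with respect to the tubular radius, the graph map
is locally almost `1`-Lipschitz. -/
theorem exists_lipschitzOnWith_graph_of_lt {η : ℝ} (hη : 0 < η) {ε : ℝ≥0} {x : Eu n} (hx : x ∈ M)
    (hηw : η < w x) (hηρ : η < ε * ρ x) :
    ∃ U ∈ 𝓝[M] x, LipschitzOnWith (1 + 2 * ε) (fun x => x + min η (w x) • ν x) U := by
  obtain ⟨⟨U, hU, hUL⟩, -⟩ := hρ.curvature_bounds hM hν hx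
  have hρx := hρ.pos x hx
  have h1 : ∀ᶠ y in 𝓝[M] x, η < w y :=
    (hwL.continuousOn x hx).eventually (lt_mem_nhds hηw)
  refine ⟨{y | y ∈ M ∧ y ∈ U ∧ η < w y},
    (eventually_mem_nhdsWithin (s := M)).and ((show ∀ᶠ y in 𝓝[M] x, y ∈ U from hU).and h1), ?_⟩
  refine lipschitzOnWith_graph (A := η) (l := 0) (fun y hy => (hν.2 y hy.1).1)
    (hUL.mono fun y hy => hy.2.1) ?_ ?_ ?_
  · refine LipschitzOnWith.of_dist_le_mul fun y hy z hz => ?_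
    rw [min_eq_left hy.2.2.le, min_eq_left hz.2.2.le]; simp
  · intro y hy
    rw [min_eq_left hy.2.2.le, abs_of_pos hη]
  · rw [Real.coe_toNNReal _ (by positivity)]
    have : η * (2 / ρ x) ≤ 2 * ε := by
      rw [mul_div_assoc', div_le_iff₀ hρx]; linarith
    push_cast; linarith

/-- As `η → 0`, the graph of `min η w` over `M` has asymptotically at most the area of `M`. -/
theorem eventually_hausdorff_graph_le (hwρ : ∀ x ∈ M, w x ≤ ρ x) (hw0 : ∀ x ∈ M, 0 < w x)
    (hMm : MeasurableSet M) (hMf : hausdorff n M < ⊤) {b : ℝ≥0∞}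
    (hb : 0 < b) :
    ∀ᶠ η in 𝓝[>] (0 : ℝ),
      hausdorff n ((fun x => x + min η (w x) • ν x) '' M) ≤ hausdorff n M + b := by
  have hb2 : 0 < b / 2 := ENNReal.half_pos hb.ne'
  obtain ⟨ε, hε, hε0⟩ : ∃ ε : ℝ≥0,
      ((1 + 2 * ε : ℝ≥0) : ℝ≥0∞) ^ n * hausdorff n M < hausdorff n M + b / 2 ∧ 0 < ε := by
    have h1 : Tendsto (fun ε : ℝ≥0 => ((1 + 2 * ε : ℝ≥0) : ℝ≥0∞) ^ n * hausdorff n M)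
        (𝓝[>] 0) (𝓝 (((1 + 2 * 0 : ℝ≥0) : ℝ≥0∞) ^ n * hausdorff n M)) := by
      refine ENNReal.Tendsto.mul_const (tendsto_nhdsWithin_of_tendsto_nhds ?_) (Or.inr hMf.ne)
      have h2 : Continuous fun ε : ℝ≥0 => ((1 + 2 * ε : ℝ≥0) : ℝ≥0∞) ^ n := by fun_prop
      exact h2.tendsto 0
    have h3 : ((1 + 2 * 0 : ℝ≥0) : ℝ≥0∞) ^ n * hausdorff n M < hausdorff n M + b / 2 := by
      simpa using ENNReal.lt_add_right hMf.ne hb2.ne'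
    obtain ⟨ε, h4, h5⟩ := ((h1.eventually (gt_mem_nhds h3)).and self_mem_nhdsWithin).exists
    exact ⟨ε, h4, h5⟩
  -- the part of `M` where the height `η` is cut off or large compared to the tubular radius
  set f : Eu n → ℝ := fun x => min (w x) (ε * ρ x) with hf
  have hfc : ContinuousOn f M := hwL.continuousOn.inf (continuousOn_const.mul hρ.continuousOn)
  have hf0 : ∀ x ∈ M, 0 < f x := fun x hx =>
    lt_min (hw0 x hx) (mul_pos (by exact_mod_cast hε0) (hρ.pos x hx))
  set B : ℝ → Set (Eu n) := fun η => f ⁻¹' Iic η ∩ M with hB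
  have hBm : ∀ η, MeasurableSet (B η) := fun η => by
    obtain ⟨C, hC, hC'⟩ := continuousOn_iff_isClosed.1 hfc (Iic η) isClosed_Iic
    simp only [hB, hC']
    exact hC.measurableSet.inter hMm
  have hBlim : Tendsto (fun η => ((5 + L : ℝ≥0) : ℝ≥0∞) ^ n * hausdorff n (B η)) (𝓝[>] 0)
      (𝓝 0) := by
    have h1 : Tendsto (hausdorff n ∘ B) (𝓝[>] 0) (𝓝 (hausdorff n (⋂ r > 0, B r))) :=
      tendsto_measure_biInter_gt (fun r _ => (hBm r).nullMeasurableSet)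
        (fun i j _ hij x hx => ⟨le_trans hx.1 hij, hx.2⟩)
        ⟨1, one_pos, ((measure_mono inter_subset_right).trans_lt hMf).ne⟩
    have h2 : (⋂ r > (0 : ℝ), B r) = ∅ := by
      refine eq_empty_of_forall_notMem fun x hx => ?_
      simp only [mem_iInter] at hx
      have h3 := hf0 x (hx 1 one_pos).2
      have h4 : f x ≤ f x / 2 := (hx (f x / 2) (by positivity)).1
      linarith
    rw [h2, measure_empty] at h1
    simpa using ENNReal.Tendsto.const_mul h1 (Or.inr (by simp))
  filter_upwards [hBlim.eventually (gt_mem_nhds hb2), self_mem_nhdsWithin] with η hη hη0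
  have hη0 : 0 < η := hη0
  have hcov : M ⊆ (M \ B η) ∪ B η := by simp
  calc hausdorff n ((fun x => x + min η (w x) • ν x) '' M)
      ≤ hausdorff n ((fun x => x + min η (w x) • ν x) '' (M \ B η)) +
        hausdorff n ((fun x => x + min η (w x) • ν x) '' B η) := by
        refine (measure_mono (image_mono hcov)).trans ?_
        rw [image_union]
        exact measure_union_le _ _
    _ ≤ ((1 + 2 * ε : ℝ≥0) : ℝ≥0∞) ^ n * hausdorff n (M \ B η) +
        ((5 + L : ℝ≥0) : ℝ≥0∞) ^ n * hausdorff n (B η) := by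
        gcongr
        · refine hausdorff_image_le_of_locally fun x hx => ?_
          have h1 : η < f x := by
            by_contra hn
            exact hx.2 ⟨not_lt.1 hn, hx.1⟩
          obtain ⟨U, hU, hUL⟩ := exists_lipschitzOnWith_graph_of_lt hρ hM hν hwL hη0 hx.1
            (h1.trans_le (min_le_left _ _)) (h1.trans_le (min_le_right _ _))
          exact ⟨U, nhdsWithin_mono _ sdiff_subset hU, hUL⟩
        · refine hausdorff_image_le_of_locally fun x hx => ?_
          obtain ⟨U, hU, hUL⟩ := exists_lipschitzOnWith_graph hρ hM hν hwL hwρ hw0 hη0 hx.2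
          exact ⟨U, nhdsWithin_mono _ inter_subset_right hU, hUL⟩
    _ ≤ (hausdorff n M + b / 2) + b / 2 := by
        refine add_le_add (le_trans ?_ hε.le) hη.le
        gcongr
        exact sdiff_subset
    _ = hausdorff n M + b := by rw [add_assoc, ENNReal.add_halves]

end Graph

/-! ### The thickness function -/

/-- Half the distance to `Z`, truncated at `1`; in particular it equals `1` if `Z` is empty. -/
noncomputable def halfDist (Z : Set (Eu n)) (x : Eu n) : ℝ := (min 1 (infEDist x Z / 2)).toReal

theorem ofReal_halfDist (Z : Set (Eu n)) (x : Eu n) :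
    ENNReal.ofReal (halfDist Z x) = min 1 (infEDist x Z / 2) :=
  ENNReal.ofReal_toReal (ne_top_of_le_ne_top ENNReal.one_ne_top (min_le_left _ _))

theorem halfDist_pos {Z : Set (Eu n)} {x : Eu n} (hx : x ∉ closure Z) : 0 < halfDist Z x := by
  rw [← ENNReal.ofReal_pos, ofReal_halfDist]
  refine lt_min one_pos (ENNReal.half_pos ?_)
  rwa [Ne, ← mem_closure_iff_infEDist_zero]

theorem halfDist_le {Z : Set (Eu n)} (x : Eu n) {z : Eu n} (hz : z ∈ Z) :
    2 * halfDist Z x ≤ dist x z := by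
  have h1 : ENNReal.ofReal (halfDist Z x) ≤ ENNReal.ofReal (dist x z / 2) := by
    rw [ofReal_halfDist, ENNReal.ofReal_div_of_pos two_pos, ← edist_dist]
    refine (min_le_right _ _).trans ?_
    simpa using ENNReal.div_le_div_right (infEDist_le_edist_of_mem hz) 2
  have := (ENNReal.ofReal_le_ofReal_iff (by positivity)).1 h1
  linarith

theorem lipschitzWith_halfDist (Z : Set (Eu n)) : LipschitzWith 1 (halfDist Z) := by
  refine LipschitzWith.of_le_add fun x y => ?_
  have h0 : 0 ≤ halfDist Z y := ENNReal.toReal_nonneg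
  rw [← ENNReal.ofReal_le_ofReal_iff (add_nonneg h0 dist_nonneg),
    ENNReal.ofReal_add h0 dist_nonneg, ofReal_halfDist, ofReal_halfDist,
    ← edist_dist, ← min_add_add_right]
  refine min_le_min (by simp) ?_
  calc infEDist x Z / 2 ≤ (infEDist y Z + edist x y) / 2 :=
        ENNReal.div_le_div_right infEDist_le_infEDist_add_edist 2
    _ = infEDist y Z / 2 + edist x y / 2 := ENNReal.add_div
    _ ≤ infEDist y Z / 2 + edist x y := by gcongr; exact ENNReal.half_le_self

/-- The curvature term of the thickness is redundant, being bounded below by `δ ρ`. -/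
theorem thickness_eq {W K S E : Set (Eu n)} {ν : Eu n → Eu n} {ρ : Eu n → ℝ} {η δ : ℝ}
    (hη : 0 < η) (hη1 : η < 1) (hδ : 0 < δ) {x : Eu n} (hρ : 0 < ρ x)
    (hcurv : curvatureNorm (collapsed K S E) ν x ≤ 1 / ρ x) :
    thickness W K S E ν ρ η δ x =
      min η (min (halfDist (S ∪ frontier E ∪ W) x) (δ * ρ x)) := by
  have h1 : ENNReal.ofReal (δ * ρ x) ≤
      ENNReal.ofReal δ / ENNReal.ofReal (curvatureNorm (collapsed K S E) ν x) := by
    rw [ENNReal.le_div_iff_mul_le (Or.inr (by simpa using hδ)) (Or.inl ENNReal.ofReal_ne_top),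
      ← ENNReal.ofReal_mul (by positivity)]
    refine ENNReal.ofReal_le_ofReal ?_
    calc δ * ρ x * curvatureNorm (collapsed K S E) ν x ≤ δ * ρ x * (1 / ρ x) := by gcongr
      _ = δ := by field_simp
  have h2 : min (ENNReal.ofReal η) (infEDist x (S ∪ frontier E ∪ W) / 2) =
      min (ENNReal.ofReal η) (ENNReal.ofReal (halfDist (S ∪ frontier E ∪ W) x)) := by
    rw [ofReal_halfDist, ← min_assoc, min_eq_left (a := ENNReal.ofReal η) (b := 1)
      (by simpa using hη1.le)]
  rw [thickness, min_eq_left h1, h2, ← ENNReal.ofReal_min, ← ENNReal.ofReal_min,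
    ENNReal.toReal_ofReal, min_assoc]
  exact le_min (le_min hη.le ENNReal.toReal_nonneg) (by positivity)

theorem IsHypersurface.inter_isOpen {k : WithTop ℕ∞} {S G : Set (Eu n)} (hS : IsHypersurface k S)
    (hG : IsOpen G) : IsHypersurface k (S ∩ G) := by
  rintro x ⟨hx, hxG⟩
  obtain ⟨U, f, hU, hxU, hf, hf0, hSU⟩ := hS x hx
  refine ⟨U ∩ G, f, hU.inter hG, ⟨hxU, hxG⟩, hf.mono inter_subset_left, fun y hy => hf0 y hy.1, ?_⟩
  ext y
  have := Set.ext_iff.1 hSU y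
  simp only [mem_inter_iff, mem_ofPred_eq] at this ⊢
  tauto

theorem IsUnitNormal.inter_isOpen {S G : Set (Eu n)} {ν : Eu n → Eu n} (hν : IsUnitNormal S ν)
    (hG : IsOpen G) : IsUnitNormal (S ∩ G) ν := by
  refine ⟨hν.1.mono inter_subset_left, fun x hx => ⟨(hν.2 x hx.1).1, ?_⟩⟩
  rw [← (hν.2 x hx.1).2]
  exact tangentConeAt_congr (nhdsWithin_inter_of_mem' (mem_nhdsWithin_of_mem_nhds
    (hG.mem_nhds hx.2)))

end SoapFilm

/-! ### The opening construction -/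

theorem lemma3p2 (n : ℕ) (hn : 2 ≤ n)
    (W : Set (Eu n)) (hW : IsCompact W) (hbdW : IsHypersurface 2 (frontier W))
    (C : Set (Circle → Eu n)) (hC : IsSpanningClass W C)
    (K E : Set (Eu n)) (hKE : MemClassK W C K E)
    -- the exceptional set, closed and with empty interior relatively to `K`
    (S : Set (Eu n)) (hSK : S ⊆ K) (hS_closed : K ∩ closure S ⊆ S)
    (hS_interior : ∀ U : Set (Eu n), IsOpen U → K ∩ U ⊆ S → K ∩ U = ∅)
    (hKS : IsHypersurface ∞ (K \ S))
    (ν : Eu n → Eu n) (hν : IsUnitNormal (K \ S) ν) :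
    -- Lipschitz tubular radii exist
    (∃ ρ : Eu n → ℝ, IsTubularRadius (collapsed K S E) ν ρ ∧
      ∃ L : ℝ≥0, LipschitzOnWith L ρ (collapsed K S E)) ∧
    -- and for each of them the construction has the asserted properties
    ∀ ρ : Eu n → ℝ, IsTubularRadius (collapsed K S E) ν ρ →
      (∃ L : ℝ≥0, LipschitzOnWith L ρ (collapsed K S E)) →
      (∀ η ∈ Ioo (0 : ℝ) 1, ∀ δ ∈ Ioo (0 : ℝ) 1,
        openedSet W K S E ν ρ η δ ⊆ Wᶜ ∧
        IsOpen (openedSet W K S E ν ρ η δ) ∧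
        IsRectifiable n (frontier (openedSet W K S E ν ρ η δ)) ∧
        K ⊆ Wᶜ ∩ frontier (openedSet W K S E ν ρ η δ) ∧
        IsSpanning C (Wᶜ ∩ frontier (openedSet W K S E ν ρ η δ))) ∧
      limsup (fun δ : ℝ => limsup (fun η : ℝ =>
          hausdorff n (Wᶜ ∩ frontier (openedSet W K S E ν ρ η δ))) (𝓝[>] 0)) (𝓝[>] 0)
        ≤ relaxedEnergy W K E := by
  set M := collapsed K S E with hMdef
  set Z := S ∪ frontier E ∪ W with hZ
  have hE := hKE.isOpen_E
  have hM_eq : M = (K \ S) ∩ (frontier E)ᶜ := collapsed_eq hE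
  have hM : IsHypersurface ∞ M := hM_eq ▸ hKS.inter_isOpen isClosed_frontier.isOpen_compl
  have hνM : IsUnitNormal M ν := hM_eq ▸ hν.inter_isOpen isClosed_frontier.isOpen_compl
  have hMK : M ⊆ K := fun x hx => (hM_eq ▸ hx : x ∈ (K \ S) ∩ (frontier E)ᶜ).1.1
  have hSm : MeasurableSet S := by
    have h1 : S = K ∩ closure S :=
      Subset.antisymm (fun x hx => ⟨hSK hx, subset_closure hx⟩) hS_closed
    rw [h1]
    exact hKE.K_rectifiable.1.inter isClosed_closure.measurableSet
  have hMm : MeasurableSet M := hM_eq ▸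
    (hKE.K_rectifiable.1.diff hSm).inter isClosed_frontier.measurableSet.compl
  have hMf : hausdorff n M < ⊤ := (measure_mono hMK).trans_lt hKE.K_rectifiable.2.2
  have hMZ : ∀ x ∈ M, x ∉ closure Z := by
    intro x hx
    have hx' : x ∈ (K \ S) ∩ (frontier E)ᶜ := hM_eq ▸ hx
    rw [hZ, closure_union, closure_union, isClosed_frontier.closure_eq, hW.isClosed.closure_eq]
    rintro ((h1 | h1) | h1)
    · exact hx'.1.2 (hS_closed ⟨hx'.1.1, h1⟩)
    · exact hx'.2 h1
    · exact hKE.K_subset hx'.1.1 h1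
  refine ⟨exists_lipschitz_isTubularRadius hM hνM, ?_⟩
  rintro ρ hρ ⟨L, hL⟩
  -- the thickness is `min η (w δ)` with `w δ` a Lipschitz function that does not involve `η`
  set w : ℝ → Eu n → ℝ := fun δ x => min (halfDist Z x) (δ * ρ x) with hw
  have hthick : ∀ η ∈ Ioo (0 : ℝ) 1, ∀ δ ∈ Ioo (0 : ℝ) 1, ∀ x ∈ M,
      thickness W K S E ν ρ η δ x = min η (w δ x) := fun η hη δ hδ x hx =>
    thickness_eq hη.1 hη.2 hδ.1 (hρ.pos x hx) (hρ.curvature_bounds hM hνM hx).2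
  have hw0 : ∀ δ ∈ Ioo (0 : ℝ) 1, ∀ x ∈ M, 0 < w δ x := fun δ hδ x hx =>
    lt_min (halfDist_pos (hMZ x hx)) (mul_pos hδ.1 (hρ.pos x hx))
  have hwρ : ∀ δ ∈ Ioo (0 : ℝ) 1, ∀ x ∈ M, w δ x < ρ x := fun δ hδ x hx =>
    (min_le_right _ _).trans_lt (mul_lt_of_lt_one_left (hρ.pos x hx) hδ.2)
  have hwL : ∀ δ ∈ Ioo (0 : ℝ) 1, LipschitzOnWith (max 1 L) (w δ) M := by
    intro δ hδ
    refine LipschitzOnWith.of_dist_le_mul fun x hx y hy => ?_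
    have h1 : |halfDist Z x - halfDist Z y| ≤ 1 * dist x y := by
      simpa [Real.dist_eq] using (lipschitzWith_halfDist Z).dist_le_mul x y
    have h2 : |δ * ρ x - δ * ρ y| ≤ L * dist x y := by
      rw [← mul_sub, abs_mul, abs_of_pos hδ.1]
      exact (mul_le_of_le_one_left (abs_nonneg _) hδ.2.le).trans (by
        simpa [Real.dist_eq] using hL.dist_le_mul x hx y hy)
    rw [Real.dist_eq, NNReal.coe_max]
    refine (abs_min_sub_min_le_max _ _ _ _).trans (max_le (h1.trans ?_) (h2.trans ?_))
    · exact mul_le_mul_of_nonneg_right (by simp) dist_nonneg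
    · exact mul_le_mul_of_nonneg_right (le_max_right _ _) dist_nonneg
  have hIs : ∀ η ∈ Ioo (0 : ℝ) 1, ∀ δ ∈ Ioo (0 : ℝ) 1,
      IsThickness M Z ν ρ (thickness W K S E ν ρ η δ) := fun η hη δ hδ =>
    { tubular := hρ
      norm_normal := fun x hx => (hνM.2 x hx).1
      continuousOn_normal := hνM.1.continuousOn
      pos := fun x hx => by rw [hthick η hη δ hδ x hx]; exact lt_min hη.1 (hw0 δ hδ x hx)
      le_one := fun x hx => by
        rw [hthick η hη δ hδ x hx]; exact (min_le_left _ _).trans hη.2.le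
      lt_radius := fun x hx => by
        rw [hthick η hη δ hδ x hx]; exact (min_le_right _ _).trans_lt (hwρ δ hδ x hx)
      two_mul_le_dist := fun x hx z hz => by
        rw [hthick η hη δ hδ x hx]
        have h1 : min η (w δ x) ≤ halfDist Z x := (min_le_right _ _).trans (min_le_left _ _)
        linarith [halfDist_le x hz]
      continuousOn := (continuousOn_const.inf (hwL δ hδ).continuousOn).congr
        fun x hx => hthick η hη δ hδ x hx }
  have hsub : ∀ η ∈ Ioo (0 : ℝ) 1, ∀ δ ∈ Ioo (0 : ℝ) 1,
      Wᶜ ∩ frontier (openedSet W K S E ν ρ η δ) ⊆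
        K ∪ (fun x => x + min η (w δ x) • ν x) '' M := by
    intro η hη δ hδ
    have h1 := (hIs η hη δ hδ).frontier_openedWith_subset hE hKE.K_relClosed hKE.frontier_subset
    have h2 : (fun x => x + thickness W K S E ν ρ η δ x • ν x) '' M =
        (fun x => x + min η (w δ x) • ν x) '' M :=
      image_congr fun x hx => by rw [hthick η hη δ hδ x hx]
    rw [← h2]
    exact h1
  refine ⟨fun η hη δ hδ => ?_, ?_⟩
  · have h := hIs η hη δ hδ
    have hFW : openedSet W K S E ν ρ η δ ⊆ Wᶜ := h.openedWith_subset hKE.E_subset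
    have hKF : K ⊆ Wᶜ ∩ frontier (openedSet W K S E ν ρ η δ) :=
      subset_inter hKE.K_subset (h.subset_frontier_openedWith hE hS_interior)
    refine ⟨hFW, h.isOpen_openedWith hE, ?_, hKF, fun γ hγ =>
      (hKE.K_spanning γ hγ).mono (inter_subset_inter_left _ hKF)⟩
    have hloc : ∀ x ∈ M, ∃ U ∈ 𝓝[M] x,
        LipschitzOnWith (5 + max 1 L) (fun x => x + min η (w δ x) • ν x) U := fun x hx =>
      exists_lipschitzOnWith_graph hρ hM hνM (hwL δ hδ) (fun x hx => (hwρ δ hδ x hx).le)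
        (hw0 δ hδ) hη.1 hx
    have hKcov : HasLipschitzCover n K := hKE.K_rectifiable.2.1
    have hcov : frontier (openedSet W K S E ν ρ η δ) ⊆
        (K ∪ (fun x => x + min η (w δ x) • ν x) '' M) ∪ frontier W := by
      intro y hy
      by_cases hyW : y ∈ W
      · refine Or.inr ?_
        rw [frontier_eq_closure_inter_closure]
        exact ⟨subset_closure hyW, closure_mono hFW (frontier_subset_closure hy)⟩
      · exact Or.inl (hsub η hη δ hδ ⟨hyW, hy⟩)
    obtain ⟨hW1, hW2⟩ := hbdW.rectifiable_of_isCompact (by norm_num)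
      (hW.of_isClosed_subset isClosed_frontier hW.isClosed.frontier_subset)
    refine ⟨isClosed_frontier.measurableSet, ((hKcov.union ((hKcov.mono hMK).image_of_locally
      fun x hx => ?_)).union hW1).mono hcov, (measure_mono hcov).trans_lt ?_⟩
    · obtain ⟨U, hU, hUL⟩ := hloc x hx
      exact ⟨U, hU, _, hUL⟩
    · refine (measure_union_le _ _).trans_lt (ENNReal.add_lt_top.2 ⟨(measure_union_le _ _).trans_lt
        (ENNReal.add_lt_top.2 ⟨hKE.K_rectifiable.2.2, ?_⟩), hW2⟩)
      exact (hausdorff_image_le_of_locally hloc).trans_lt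
        (ENNReal.mul_lt_top (ENNReal.pow_lt_top ENNReal.coe_lt_top) hMf)
  -- `M` is the part of `K` off the reduced boundary that is counted twice in the limit
  have henergy : hausdorff n K + hausdorff n M ≤ relaxedEnergy W K E := by
    have h1 : hausdorff n K ≤
        hausdorff n (Wᶜ ∩ reducedBoundary E) + hausdorff n (K \ reducedBoundary E) := by
      refine (measure_mono (t := (Wᶜ ∩ reducedBoundary E) ∪ (K \ reducedBoundary E)) ?_).trans
        (measure_union_le _ _)
      intro x hx
      by_cases hxE : x ∈ reducedBoundary E
      · exact Or.inl ⟨hKE.K_subset hx, hxE⟩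
      · exact Or.inr ⟨hx, hxE⟩
    have h2 : M ⊆ K \ reducedBoundary E := fun x hx => by
      refine ⟨hMK hx, fun hxE => ?_⟩
      have h3 : x ∈ Wᶜ ∩ frontier E := by
        rw [← hKE.closure_reducedBoundary]
        exact ⟨hKE.K_subset (hMK hx), subset_closure hxE⟩
      exact (hM_eq ▸ hx : x ∈ (K \ S) ∩ (frontier E)ᶜ).2 h3.2
    calc hausdorff n K + hausdorff n M ≤
        (hausdorff n (Wᶜ ∩ reducedBoundary E) + hausdorff n (K \ reducedBoundary E)) +
          hausdorff n (K \ reducedBoundary E) := add_le_add h1 (measure_mono h2)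
      _ = relaxedEnergy W K E := by rw [relaxedEnergy, two_mul, add_assoc]
  have hIoo : ∀ᶠ t in 𝓝[>] (0 : ℝ), t ∈ Ioo (0 : ℝ) 1 := Ioo_mem_nhdsGT one_pos
  refine limsup_le_of_le (by isBoundedDefault) ?_
  filter_upwards [hIoo] with δ hδ
  refine le_trans (ENNReal.le_of_forall_pos_le_add fun b hb _ => ?_) henergy
  refine limsup_le_of_le (by isBoundedDefault) ?_
  filter_upwards [hIoo, eventually_hausdorff_graph_le hρ hM hνM (hwL δ hδ)
    (fun x hx => (hwρ δ hδ x hx).le) (hw0 δ hδ) hMm hMf (b := b) (by exact_mod_cast hb)] with η hη h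
  calc hausdorff n (Wᶜ ∩ frontier (openedSet W K S E ν ρ η δ))
      ≤ hausdorff n K + hausdorff n ((fun x => x + min η (w δ x) • ν x) '' M) :=
        (measure_mono (hsub η hη δ hδ)).trans (measure_union_le _ _)
    _ ≤ hausdorff n K + (hausdorff n M + b) := by gcongr
    _ = hausdorff n K + hausdorff n M + b := by rw [add_assoc]
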